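/- Let $K$ be a field and let $H$ be a Hopf algebra over $K$ with comultiplication $\Delta$, counit $\varepsilon$ and bijective antipode $S$; coactions of right $H$-comodules are written $\rho(v)=\sum v_0\otimes v_1$, and $Comod\text{-}H$ is the category of right $H$-comodules and $H$-colinear maps. Let $\mathcal D$ be a right co-$H$-category, i.e. a small $K$-linear category whose morphism spaces are right $H$-comodules, with $\rho(\mathrm{id}_X)=\mathrm{id}_X\otimes 1_H$ and $\rho(fg)=\sum f_0g_0\otimes f_1g_1$ for composable $f,g$. A left $\mathcal D$-module is a $K$-linear functor $\mathcal D\to Vect_K$. A relative $(\mathcal D,H)$-Hopf module is a left $\mathcal D$-module $\mathcal M$ with a right $H$-comodule structure on each $\mathcal M(X)$ such that $\rho(\mathcal M(f)(m))=\sum \mathcal M(f_0)(m_0)\otimes f_1m_1$ for all $f\in Hom_{\mathcal D}(X,Y)$, $m\in\mathcal M(X)$. These form a category ${}_{\mathcal D}\mathscr M^H$, whose morphisms are the morphisms of $\mathcal D$-modules with $H$-colinear components. For $\mathcal M\in{}_{\mathcal D}\mathscr M^H$ let $\mathcal M\otimes(-):Comod\text{-}H\to{}_{\mathcal D}\mathscr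 M^H$ be the functor with $(\mathcal M\otimes T)(X)=\mathcal M(X)\otimes T$, $(\mathcal M\otimes T)(f)(m\otimes t)=\mathcal M(f)(m)\otimes t$ and $\rho(m\otimes t)=\sum m_0\otimes t_0\otimes m_1t_1$. It has a right adjoint, which is denoted $HOM_{\mathcal D\text{-}Mod}(\mathcal M,-):{}_{\mathcal D}\mathscr M^H\to Comod\text{-}H$. Let $\mathcal M\in{}_{\mathcal D}\mathscr M^H$ be finitely generated as a $\mathcal D$-module, i.e. there are finitely many elements $m_i\in\mathcal M(X_i)$ such that every $y\in\mathcal M(Y)$, for every $Y$, has the form $\sum_i\mathcal M(f_i)(m_i)$ with $f_i\in Hom_{\mathcal D}(X_i,Y)$. Then: (1) For every $\mathcal N\in{}_{\mathcal D}\mathscr M^H$, the vector space $Hom_{\mathcal D\text{-}Mod}(\mathcal M,\mathcal N)$ of all morphisms of $\mathcal D$-modules is a right $H$-comodule with a coaction $\eta\mapsto\sum\eta_0\otimes\eta_1\in Hom_{\mathcal D\text{-}Mod}(\mathcal M,\mathcal N)\otimes H$ satisfying $$\sum \eta_0(X)(m)\otimes\eta_1=\sum\big(\eta(X)(m_0)\big)_0\otimes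 S^{-1}(m_1)\big(\eta(X)(m_0)\big)_1\qquad (X\in Ob(\mathcal D),\ m\in\mathcal M(X)),$$ and composition with any morphism $\mathcal N\to\mathcal N'$ in ${}_{\mathcal D}\mathscr M^H$ is colinear, so that $Hom_{\mathcal D\text{-}Mod}(\mathcal M,-)$ is a functor ${}_{\mathcal D}\mathscr M^H\to Comod\text{-}H$. (2) $HOM_{\mathcal D\text{-}Mod}(\mathcal M,-)= Hom_{\mathcal D\text{-}Mod}(\mathcal M,-)$, that is, the maps $HOM_{\mathcal D\text{-}Mod}(\mathcal M,\mathcal N)\to Hom_{\mathcal D\text{-}Mod}(\mathcal M,\mathcal N)$ sending $z$ to the morphism $m\mapsto\epsilon_{\mathcal N}(m\otimes z)$, where $\epsilon$ is the counit of the adjunction, are isomorphisms of $H$-comodules, natural in $\mathcal N$. -/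

import Mathlib

open CategoryTheory TensorProduct

universe k v w

section Comodules

variable (K : Type k) [Field K] (H : Type w) [Ring H] [HopfAlgebra K H]

/-- A right `H`-comodule structure `ρ : V → V ⊗ H` on the `K`-vector space `V`. -/
@[ext]
structure RightComodule (V : Type*) [AddCommGroup V] [Module K V] where
  /-- The coaction `v ↦ ∑ v₀ ⊗ v₁`. -/
  coact : V →ₗ[K] V ⊗[K] H
  /-- `(ρ ⊗ id) ∘ ρ = (id ⊗ Δ) ∘ ρ`. -/
  coassoc : ∀ x : V, TensorProduct.assoc K V H H (coact.rTensor H (coact x)) =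
    (Coalgebra.comul (R := K) (A := H)).lTensor V (coact x)
  /-- `(id ⊗ ε) ∘ ρ = id`. -/
  counit : ∀ x : V, TensorProduct.rid K V
    ((Coalgebra.counit (R := K) (A := H)).lTensor V (coact x)) = x

/-- For a bilinear map `b : U × V → W`, the induced pairing
`(U ⊗ H) × (V ⊗ H) → W ⊗ H`, `(u ⊗ g, v ⊗ h) ↦ b(u, v) ⊗ g h`. -/
noncomputable def pairCoact {U V W : Type*} [AddCommGroup U] [Module K U] [AddCommGroup V]
    [Module K V] [AddCommGroup W] [Module K W] (b : U →ₗ[K] V →ₗ[K] W) :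
    (U ⊗[K] H) →ₗ[K] (V ⊗[K] H) →ₗ[K] (W ⊗[K] H) :=
  TensorProduct.map₂ b (LinearMap.mul K H)

variable {K H}

/-- The tensor product of right `H`-comodules, `v ⊗ w ↦ ∑ (v₀ ⊗ w₀) ⊗ v₁ w₁`. -/
noncomputable def RightComodule.tensor {V W : Type*} [AddCommGroup V] [Module K V]
    [AddCommGroup W] [Module K W] (c : RightComodule K H V) (d : RightComodule K H W) :
    RightComodule K H (V ⊗[K] W) where
  coact := TensorProduct.lift
    ((pairCoact K H (TensorProduct.mk K V W)).compl₁₂ c.coact d.coact)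
  coassoc := by
    let T := pairCoact K H (TensorProduct.mk K V W)
    let B : (V ⊗[K] (H ⊗[K] H)) →ₗ[K] (W ⊗[K] (H ⊗[K] H)) →ₗ[K]
        ((V ⊗[K] W) ⊗[K] (H ⊗[K] H)) :=
      TensorProduct.map₂ (TensorProduct.mk K V W) (LinearMap.mul K (H ⊗[K] H))
    let R := TensorProduct.lift (T.compl₁₂ c.coact d.coact)
    have key0 : ∀ (a : V ⊗[K] H) (b : W ⊗[K] H) (g g' : H),
        TensorProduct.assoc K (V ⊗[K] W) H H (T a b ⊗ₜ (g * g')) =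
          B (TensorProduct.assoc K V H H (a ⊗ₜ g)) (TensorProduct.assoc K W H H (b ⊗ₜ g')) := by
      intro a b g g'
      induction a with
      | zero => simp
      | add a a' ha ha' => simp only [map_add, LinearMap.add_apply, TensorProduct.add_tmul, ha, ha']
      | tmul x p =>
        induction b with
        | zero => simp
        | add b b' hb hb' => simp only [map_add, TensorProduct.add_tmul, hb, hb']
        | tmul y q => simp [T, B, pairCoact]
    have key1 : ∀ (a : V ⊗[K] H) (b : W ⊗[K] H),
        TensorProduct.assoc K (V ⊗[K] W) H H (R.rTensor H (T a b)) =
          B (TensorProduct.assoc K V H H (c.coact.rTensor H a))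
            (TensorProduct.assoc K W H H (d.coact.rTensor H b)) := by
      intro a b
      induction a with
      | zero => simp
      | add a a' ha ha' => simp only [map_add, LinearMap.add_apply, ha, ha']
      | tmul x p =>
        induction b with
        | zero => simp
        | add b b' hb hb' => simp only [map_add, hb, hb']
        | tmul y q =>
          simp only [LinearMap.rTensor_tmul, ← key0]
          simp [T, R, pairCoact]
    have key2 : ∀ (a : V ⊗[K] H) (b : W ⊗[K] H),
        (Coalgebra.comul (R := K) (A := H)).lTensor (V ⊗[K] W) (T a b) =
          B ((Coalgebra.comul (R := K) (A := H)).lTensor V a)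
            ((Coalgebra.comul (R := K) (A := H)).lTensor W b) := by
      intro a b
      induction a with
      | zero => simp
      | add a a' ha ha' => simp only [map_add, LinearMap.add_apply, ha, ha']
      | tmul x p =>
        induction b with
        | zero => simp
        | add b b' hb hb' => simp only [map_add, hb, hb']
        | tmul y q => simp [T, B, pairCoact]
    intro z
    change TensorProduct.assoc K (V ⊗[K] W) H H (R.rTensor H (R z)) =
      (Coalgebra.comul (R := K) (A := H)).lTensor (V ⊗[K] W) (R z)
    induction z with
    | zero => simp
    | add z z' hz hz' => simp only [map_add, hz, hz']
    | tmul x y =>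
      have hR : R (x ⊗ₜ y) = T (c.coact x) (d.coact y) := by simp [R]
      rw [hR, key1, key2, c.coassoc, d.coassoc]
  counit := by
    let T := pairCoact K H (TensorProduct.mk K V W)
    have key : ∀ (a : V ⊗[K] H) (b : W ⊗[K] H), TensorProduct.rid K (V ⊗[K] W)
        ((Coalgebra.counit (R := K) (A := H)).lTensor (V ⊗[K] W) (T a b)) =
        TensorProduct.rid K V ((Coalgebra.counit (R := K) (A := H)).lTensor V a) ⊗ₜ
        TensorProduct.rid K W ((Coalgebra.counit (R := K) (A := H)).lTensor W b) := by
      intro a b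
      induction a with
      | zero => simp
      | add a a' ha ha' =>
        simp only [map_add, LinearMap.add_apply, TensorProduct.add_tmul, ha, ha']
      | tmul x p =>
        induction b with
        | zero => simp
        | add b b' hb hb' => simp only [map_add, TensorProduct.tmul_add, hb, hb']
        | tmul y q =>
          simp only [T, pairCoact, TensorProduct.map₂_apply_tmul, TensorProduct.map_tmul,
            TensorProduct.mk_apply, LinearMap.mul_apply', LinearMap.lTensor_tmul,
            Bialgebra.counit_mul, TensorProduct.rid_tmul, TensorProduct.smul_tmul_smul]
    intro z
    induction z with
    | zero => simp
    | add z z' hz hz' => simp only [map_add, hz, hz']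
    | tmul x y =>
      have := key (c.coact x) (d.coact y)
      rw [c.counit, d.counit] at this
      simpa [T] using this

theorem pairCoact_pairCoact {U A B V : Type*} [AddCommGroup U] [Module K U]
    [AddCommGroup A] [Module K A] [AddCommGroup B] [Module K B] [AddCommGroup V] [Module K V]
    (b : U →ₗ[K] A →ₗ[K] B) (b' : U →ₗ[K] A ⊗[K] V →ₗ[K] B ⊗[K] V)
    (hb : ∀ u m t, b' u (m ⊗ₜ t) = b u m ⊗ₜ t) (x : U ⊗[K] H) (a : A ⊗[K] H)
    (e : V ⊗[K] H) :
    pairCoact K H (TensorProduct.mk K B V) (pairCoact K H b x a) e =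
      pairCoact K H b' x (pairCoact K H (TensorProduct.mk K A V) a e) := by
  induction x with
  | zero => simp
  | add x x' hx hx' => simp only [map_add, LinearMap.add_apply, hx, hx']
  | tmul u p =>
    induction a with
    | zero => simp
    | add a a' ha ha' => simp only [map_add, LinearMap.add_apply, ha, ha']
    | tmul m q =>
      induction e with
      | zero => simp
      | add e e' he he' => simp only [map_add, he, he']
      | tmul t r => simp [pairCoact, hb, mul_assoc]

theorem RightComodule.tensor_coact_tmul {V W : Type*} [AddCommGroup V] [Module K V]
    [AddCommGroup W] [Module K W] (c : RightComodule K H V) (d : RightComodule K H W)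
    (x : V) (y : W) : (c.tensor d).coact (x ⊗ₜ y) =
      pairCoact K H (TensorProduct.mk K V W) (c.coact x) (d.coact y) := by
  simp [RightComodule.tensor]

theorem RightComodule.tensor_coact_rTensor {U A B V : Type*} [AddCommGroup U] [Module K U]
    [AddCommGroup A] [Module K A] [AddCommGroup B] [Module K B] [AddCommGroup V] [Module K V]
    (cA : RightComodule K H A) (cB : RightComodule K H B) (d : RightComodule K H V)
    (b : U →ₗ[K] A →ₗ[K] B) (b' : U →ₗ[K] A ⊗[K] V →ₗ[K] B ⊗[K] V)
    (hb : ∀ u m t, b' u (m ⊗ₜ t) = b u m ⊗ₜ t) (g : A →ₗ[K] B) (x : U ⊗[K] H)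
    (hg : ∀ m, cB.coact (g m) = pairCoact K H b x (cA.coact m)) (z : A ⊗[K] V) :
    (cB.tensor d).coact (g.rTensor V z) = pairCoact K H b' x ((cA.tensor d).coact z) := by
  induction z with
  | zero => simp
  | add z z' hz hz' => simp only [map_add, hz, hz']
  | tmul m t =>
    rw [LinearMap.rTensor_tmul, tensor_coact_tmul, tensor_coact_tmul, hg,
      pairCoact_pairCoact b b' hb]

theorem RightComodule.tensor_coact_lTensor {A V V' : Type*} [AddCommGroup A] [Module K A]
    [AddCommGroup V] [Module K V] [AddCommGroup V'] [Module K V']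
    (c : RightComodule K H A) (d : RightComodule K H V) (d' : RightComodule K H V')
    (g : V →ₗ[K] V') (hg : ∀ t, d'.coact (g t) = g.rTensor H (d.coact t)) (z : A ⊗[K] V) :
    (c.tensor d').coact (g.lTensor A z) = (g.lTensor A).rTensor H ((c.tensor d).coact z) := by
  have key : ∀ (a : A ⊗[K] H) (e : V ⊗[K] H),
      pairCoact K H (TensorProduct.mk K A V') a (g.rTensor H e) =
      (g.lTensor A).rTensor H (pairCoact K H (TensorProduct.mk K A V) a e) := by
    intro a e
    induction a with
    | zero => simp
    | add a a' ha ha' => simp only [map_add, LinearMap.add_apply, ha, ha']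
    | tmul m q =>
      induction e with
      | zero => simp
      | add e e' he he' => simp only [map_add, he, he']
      | tmul t r => simp [pairCoact]
  induction z with
  | zero => simp
  | add z z' hz hz' => simp only [map_add, hz, hz']
  | tmul m t => rw [LinearMap.lTensor_tmul, tensor_coact_tmul, tensor_coact_tmul, hg, key]

/-- The cofree right `H`-comodule `V ⊗ H` on a vector space `V`, with coaction `id ⊗ Δ`. -/
noncomputable def RightComodule.cofree (V : Type*) [AddCommGroup V] [Module K V] :
    RightComodule K H (V ⊗[K] H) where
  coact := (TensorProduct.assoc K V H H).symm.toLinearMap ∘ₗ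
    (Coalgebra.comul (R := K) (A := H)).lTensor V
  coassoc := by
    have key1 : ∀ (x : V) (y : H ⊗[K] H),
        TensorProduct.assoc K (V ⊗[K] H) H H
          (((TensorProduct.assoc K V H H).symm.toLinearMap ∘ₗ
            (Coalgebra.comul (R := K) (A := H)).lTensor V).rTensor H
              ((TensorProduct.assoc K V H H).symm (x ⊗ₜ y))) =
        (TensorProduct.assoc K V H (H ⊗[K] H)).symm (x ⊗ₜ
          (TensorProduct.assoc K H H H ((Coalgebra.comul (R := K) (A := H)).rTensor H y))) := by
      intro x y
      induction y with
      | zero => simp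
      | add y y' hy hy' => simp only [map_add, TensorProduct.tmul_add, hy, hy']
      | tmul p q =>
        simp only [TensorProduct.assoc_symm_tmul, LinearMap.rTensor_tmul, LinearMap.comp_apply,
          LinearMap.lTensor_tmul, LinearEquiv.coe_coe]
        generalize (Coalgebra.comul (R := K) (A := H)) p = u
        induction u with
        | zero => simp
        | add u u' hu hu' => simp only [map_add, TensorProduct.tmul_add, TensorProduct.add_tmul,
            hu, hu']
        | tmul a b => simp
    have key2 : ∀ (x : V) (y : H ⊗[K] H),
        (Coalgebra.comul (R := K) (A := H)).lTensor (V ⊗[K] H)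
          ((TensorProduct.assoc K V H H).symm (x ⊗ₜ y)) =
        (TensorProduct.assoc K V H (H ⊗[K] H)).symm (x ⊗ₜ
          ((Coalgebra.comul (R := K) (A := H)).lTensor H y)) := by
      intro x y
      induction y with
      | zero => simp
      | add y y' hy hy' => simp only [map_add, TensorProduct.tmul_add, hy, hy']
      | tmul p q => simp
    intro z
    induction z with
    | zero => simp
    | add z z' hz hz' => simp only [map_add, hz, hz']
    | tmul x p =>
      have e : ((TensorProduct.assoc K V H H).symm.toLinearMap ∘ₗ
          (Coalgebra.comul (R := K) (A := H)).lTensor V) (x ⊗ₜ p) =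
          (TensorProduct.assoc K V H H).symm (x ⊗ₜ Coalgebra.comul p) := by simp
      rw [e, key1, key2, Coalgebra.coassoc_apply]
  counit := by
    have key : ∀ (x : V) (y : H ⊗[K] H), TensorProduct.rid K (V ⊗[K] H)
        ((Coalgebra.counit (R := K) (A := H)).lTensor (V ⊗[K] H)
          ((TensorProduct.assoc K V H H).symm (x ⊗ₜ y))) =
        x ⊗ₜ TensorProduct.rid K H ((Coalgebra.counit (R := K) (A := H)).lTensor H y) := by
      intro x y
      induction y with
      | zero => simp
      | add y y' hy hy' => simp only [map_add, TensorProduct.tmul_add, hy, hy']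
      | tmul p q => simp
    intro z
    induction z with
    | zero => simp
    | add z z' hz hz' => simp only [map_add, hz, hz']
    | tmul x p =>
      have := key x (Coalgebra.comul p)
      simpa using this

theorem RightComodule.cofree_coact_rTensor {V W : Type*} [AddCommGroup V] [Module K V]
    [AddCommGroup W] [Module K W] (f : V →ₗ[K] W) (z : V ⊗[K] H) :
    (RightComodule.cofree W).coact (f.rTensor H z) =
      (f.rTensor H).rTensor H ((RightComodule.cofree V).coact z) := by
  induction z with
  | zero => simp
  | add z z' hz hz' => simp only [map_add, hz, hz']
  | tmul x p =>
    simp only [RightComodule.cofree, LinearMap.rTensor_tmul, LinearMap.comp_apply,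
      LinearMap.lTensor_tmul, LinearEquiv.coe_coe]
    generalize (Coalgebra.comul (R := K) (A := H)) p = u
    induction u with
    | zero => simp
    | add u u' hu hu' => simp only [map_add, TensorProduct.tmul_add, hu, hu']
    | tmul a b => simp

/-- `(ρ ⊗ id) ∘ ρ` is the coaction of the cofree comodule `V ⊗ H` composed with `ρ`. -/
theorem RightComodule.cofree_coact_coact {V : Type*} [AddCommGroup V] [Module K V]
    (c : RightComodule K H V) (x : V) :
    (RightComodule.cofree V).coact (c.coact x) = c.coact.rTensor H (c.coact x) := by
  simp only [RightComodule.cofree, LinearMap.comp_apply, LinearEquiv.coe_coe]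
  rw [← c.coassoc, LinearEquiv.symm_apply_apply]

/-- `id ⊗ ε : V ⊗ H → V`. -/
noncomputable def idCounit (K : Type k) [Field K] (H : Type w) [Ring H] [HopfAlgebra K H]
    (V : Type*) [AddCommGroup V] [Module K V] :
    V ⊗[K] H →ₗ[K] V :=
  (TensorProduct.rid K V).toLinearMap ∘ₗ (Coalgebra.counit (R := K) (A := H)).lTensor V

theorem idCounit_rTensor {V W : Type*} [AddCommGroup V] [Module K V]
    [AddCommGroup W] [Module K W] (f : V →ₗ[K] W) (z : V ⊗[K] H) :
    idCounit K H W (f.rTensor H z) = f (idCounit K H V z) := by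
  induction z with
  | zero => simp
  | add z z' hz hz' => simp only [map_add, hz, hz']
  | tmul x p => simp [idCounit]

theorem rTensor_idCounit_cofree {V : Type*} [AddCommGroup V] [Module K V] (z : V ⊗[K] H) :
    (idCounit K H V).rTensor H ((RightComodule.cofree V).coact z) = z := by
  have key : ∀ (x : V) (y : H ⊗[K] H),
      (idCounit K H V).rTensor H ((TensorProduct.assoc K V H H).symm (x ⊗ₜ y)) =
      x ⊗ₜ TensorProduct.lid K H ((Coalgebra.counit (R := K) (A := H)).rTensor H y) := by
    intro x y
    induction y with
    | zero => simp
    | add y y' hy hy' => simp only [map_add, TensorProduct.tmul_add, hy, hy']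
    | tmul p q => simp [idCounit, TensorProduct.smul_tmul]
  induction z with
  | zero => simp
  | add z z' hz hz' => simp only [map_add, hz, hz']
  | tmul x p =>
    have := key x (Coalgebra.comul p)
    simpa [RightComodule.cofree] using this

theorem rTensor_subtype_injective {V : Type*} [AddCommGroup V] [Module K V] (L : Type*)
    [AddCommGroup L] [Module K L] (P : Submodule K V) :
    Function.Injective (P.subtype.rTensor L) :=
  Module.Flat.rTensor_preserves_injective_linearMap _ P.injective_subtype

/-- The comodule structure on a subspace `P` with `ρ(P) ⊆ P ⊗ H`. -/
noncomputable def RightComodule.restrict {V : Type*} [AddCommGroup V] [Module K V]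
    (c : RightComodule K H V) (P : Submodule K V)
    (hP : ∀ z ∈ P, c.coact z ∈ LinearMap.range (P.subtype.rTensor H)) :
    RightComodule K H P :=
  let r : P →ₗ[K] P ⊗[K] H :=
    (LinearEquiv.ofInjective (P.subtype.rTensor H)
      (rTensor_subtype_injective H P)).symm.toLinearMap ∘ₗ
    (c.coact ∘ₗ P.subtype).codRestrict _ (fun z => hP z z.2)
  have hr : ∀ z : P, P.subtype.rTensor H (r z) = c.coact z := fun z =>
    congrArg Subtype.val ((LinearEquiv.ofInjective (P.subtype.rTensor H)
      (rTensor_subtype_injective H P)).apply_symm_apply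
        ((c.coact ∘ₗ P.subtype).codRestrict _ (fun z => hP z z.2) z))
  { coact := r
    coassoc := fun z => by
      apply rTensor_subtype_injective (H ⊗[K] H) P
      have e1 : ∀ y : (P ⊗[K] H) ⊗[K] H, P.subtype.rTensor (H ⊗[K] H)
          (TensorProduct.assoc K P H H y) =
          TensorProduct.assoc K V H H ((P.subtype.rTensor H).rTensor H y) := by
        intro y
        induction y with
        | zero => simp
        | add y y' hy hy' => simp only [map_add, hy, hy']
        | tmul a q =>
          induction a with
          | zero => simp
          | add a a' ha ha' => simp only [map_add, TensorProduct.add_tmul, ha, ha']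
          | tmul x p => simp
      have e2 : ∀ y : P ⊗[K] H, P.subtype.rTensor (H ⊗[K] H)
          ((Coalgebra.comul (R := K) (A := H)).lTensor P y) =
          (Coalgebra.comul (R := K) (A := H)).lTensor V (P.subtype.rTensor H y) := by
        intro y
        induction y with
        | zero => simp
        | add y y' hy hy' => simp only [map_add, hy, hy']
        | tmul a q => simp
      have e3 : (P.subtype.rTensor H) ∘ₗ r = c.coact ∘ₗ P.subtype := LinearMap.ext hr
      rw [e1, e2, hr, ← c.coassoc, ← hr, ← LinearMap.rTensor_comp_apply, e3,
        LinearMap.rTensor_comp_apply]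
    counit := fun z => by
      apply Subtype.ext
      have := c.counit z
      rw [← hr] at this
      refine Eq.trans ?_ this
      exact (idCounit_rTensor P.subtype (r z)).symm }

theorem RightComodule.restrict_coact {V : Type*} [AddCommGroup V] [Module K V]
    (c : RightComodule K H V) (P : Submodule K V)
    (hP : ∀ z ∈ P, c.coact z ∈ LinearMap.range (P.subtype.rTensor H)) (z : P) :
    P.subtype.rTensor H ((c.restrict P hP).coact z) = c.coact z :=
  congrArg Subtype.val ((LinearEquiv.ofInjective (P.subtype.rTensor H)
    (rTensor_subtype_injective H P)).apply_symm_apply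
      ((c.coact ∘ₗ P.subtype).codRestrict _ (fun z => hP z z.2) z))

theorem mem_range_rTensor_subtype {V : Type*} [AddCommGroup V] [Module K V]
    (P : Submodule K V) (y : V ⊗[K] H)
    (h : ∀ φ : H →ₗ[K] K, TensorProduct.rid K V (φ.lTensor V y) ∈ P) :
    y ∈ LinearMap.range (P.subtype.rTensor H) := by
  classical
  let b := Module.Basis.ofVectorSpace K H
  rw [← (TensorProduct.equivFinsuppOfBasisRight (M := V) b).symm_apply_apply y,
    TensorProduct.equivFinsuppOfBasisRight_symm_apply]
  refine Submodule.sum_mem _ fun i _ => ?_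
  have hi : TensorProduct.equivFinsuppOfBasisRight (M := V) b y i ∈ P := by
    rw [TensorProduct.equivFinsuppOfBasisRight_apply]
    exact h _
  exact ⟨⟨_, hi⟩ ⊗ₜ b i, LinearMap.rTensor_tmul _ _ _ _⟩

variable (K H)

/-- The objects of the category `Comod-H` of right `H`-comodules. -/
structure ComodCat where
  /-- The underlying vector space. -/
  carrier : Type w
  [addCommGroup : AddCommGroup carrier]
  [module : Module K carrier]
  /-- The right `H`-comodule structure. -/
  str : RightComodule K H carrier

attribute [instance] ComodCat.addCommGroup ComodCat.module

variable {K H}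

/-- Morphisms of `Comod-H`: the `H`-colinear maps. -/
@[ext]
structure ComodCat.Hom (T T' : ComodCat.{k, w} K H) where
  /-- The underlying linear map. -/
  lin : T.carrier →ₗ[K] T'.carrier
  /-- `ρ (f t) = (f ⊗ id) (ρ t)`. -/
  colinear : ∀ t, T'.str.coact (lin t) = lin.rTensor H (T.str.coact t)

instance : Category (ComodCat.{k, w} K H) where
  Hom := ComodCat.Hom
  id T := ⟨LinearMap.id, fun t => by simp⟩
  comp f g := ⟨g.lin ∘ₗ f.lin, fun t => by
    simp [f.colinear, g.colinear, LinearMap.rTensor_comp]⟩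

end Comodules

section CoHCategories

variable (K : Type k) [Field K] (H : Type w) [Ring H] [HopfAlgebra K H]
  (D : Type w) [Category.{v} D] [Preadditive D] [Linear K D]

/-- A right co-`H`-category: a small `K`-linear category enriched over right `H`-comodules.
The composite written `f g` in the order of functions is `g ≫ f` here. -/
class CoHCategory where
  /-- The coaction `ρ_{XY}(f) = ∑ f₀ ⊗ f₁`. -/
  homComodule : ∀ X Y : D, RightComodule K H (X ⟶ Y)
  /-- `ρ(id_X) = id_X ⊗ 1`. -/
  coact_id : ∀ X : D, (homComodule X X).coact (𝟙 X) = 𝟙 X ⊗ₜ[K] (1 : H)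
  /-- `ρ(f g) = ∑ f₀ g₀ ⊗ f₁ g₁`. -/
  coact_comp : ∀ {X Y Z : D} (g : X ⟶ Y) (f : Y ⟶ Z),
    (homComodule X Z).coact (g ≫ f) =
      pairCoact K H (Linear.comp (S := K) X Y Z).flip
        ((homComodule Y Z).coact f) ((homComodule X Y).coact g)

variable {K D}

/-- For a left `D`-module `F`, i.e. a `K`-linear functor `D ⥤ Vect_K`, the action
`Hom_D(X, Y) × F(X) → F(Y)`, `(f, m) ↦ F(f)(m)` as a bilinear map. -/
noncomputable def modAction (F : D ⥤ ModuleCat.{w} K) [F.Additive] [F.Linear K] (X Y : D) :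
    (X ⟶ Y) →ₗ[K] F.obj X →ₗ[K] F.obj Y :=
  (ModuleCat.homLinearEquiv (S := K)).toLinearMap ∘ₗ F.mapLinearMap K

variable (K D) [CoHCategory K H D]

/-- Relative `(D, H)`-Hopf modules. -/
structure RelHopfModule where
  /-- The underlying left `D`-module, a `K`-linear functor `D ⥤ Vect_K`. -/
  toMod : D ⥤ ModuleCat.{w} K
  [additive : toMod.Additive]
  [linear : toMod.Linear K]
  /-- The right `H`-comodule structure on each `M(X)`. -/
  comodule : ∀ X : D, RightComodule K H (toMod.obj X)
  /-- `ρ(M(f)(m)) = ∑ M(f₀)(m₀) ⊗ f₁ m₁`. -/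
  coact_map : ∀ {X Y : D} (f : X ⟶ Y) (m : toMod.obj X),
    (comodule Y).coact (toMod.map f m) =
      pairCoact K H (modAction toMod X Y)
        ((CoHCategory.homComodule (H := H) X Y).coact f) ((comodule X).coact m)

attribute [instance] RelHopfModule.additive RelHopfModule.linear

variable {K H D}

/-- Morphisms of relative Hopf modules: the morphisms of `D`-modules all of whose components
are `H`-colinear. -/
@[ext]
structure RelHopfModule.Hom (M N : RelHopfModule K H D) where
  /-- The underlying morphism of left `D`-modules. -/
  nat : M.toMod ⟶ N.toMod
  colinear : ∀ (X : D) (m : M.toMod.obj X),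
    (N.comodule X).coact (nat.app X m) =
      (nat.app X).hom.rTensor H ((M.comodule X).coact m)

instance : Category (RelHopfModule K H D) where
  Hom := RelHopfModule.Hom
  id M := ⟨𝟙 _, fun X m => by simp⟩
  comp f g := ⟨f.nat ≫ g.nat, fun X m => by
    simp [f.colinear, g.colinear, LinearMap.rTensor_comp]⟩

namespace RelHopfModule

/-- The `K`-vector space `Hom_{D-Mod}(M, N)` of morphisms of the underlying left `D`-modules
(natural transformations, not required to be colinear). -/
abbrev DHom (M N : RelHopfModule K H D) : Type w := M.toMod ⟶ N.toMod

/-- `M` is finitely generated as a left `D`-module: there are finitely many elements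
`mᵢ ∈ M(Xᵢ)` such that every `y ∈ M(Y)` is of the form `∑ M(fᵢ)(mᵢ)` with `fᵢ : Xᵢ → Y`. -/
def IsFinGen (M : RelHopfModule K H D) : Prop :=
  ∃ (n : ℕ) (X : Fin n → D) (m : ∀ i, M.toMod.obj (X i)),
    ∀ (Y : D) (y : M.toMod.obj Y), ∃ f : ∀ i, X i ⟶ Y, y = ∑ i, M.toMod.map (f i) (m i)

/-- The left `D`-module `F ⊗ V` for a vector space `V`, with `(F ⊗ V)(X) = F(X) ⊗ V` and
`(F ⊗ V)(f)(m ⊗ t) = F(f)(m) ⊗ t`. -/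
noncomputable def tensorMod (F : D ⥤ ModuleCat.{w} K) (V : Type w) [AddCommGroup V]
    [Module K V] : D ⥤ ModuleCat.{w} K where
  obj X := ModuleCat.of K (F.obj X ⊗[K] V)
  map f := ModuleCat.ofHom ((F.map f).hom.rTensor V)
  map_id X := by ext : 1; simp
  map_comp f g := by ext : 1; simp [LinearMap.rTensor_comp]

instance (F : D ⥤ ModuleCat.{w} K) (V : Type w) [AddCommGroup V] [Module K V] [F.Additive] :
    (tensorMod F V).Additive where
  map_add {X Y f g} := by
    apply ModuleCat.hom_ext
    change ((F.map (f + g)).hom.rTensor V) = (F.map f).hom.rTensor V + (F.map g).hom.rTensor V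
    rw [F.map_add, ModuleCat.hom_add, LinearMap.rTensor_add]

instance (F : D ⥤ ModuleCat.{w} K) (V : Type w) [AddCommGroup V] [Module K V] [F.Linear K] :
    (tensorMod F V).Linear K where
  map_smul {X Y} f r := by
    apply ModuleCat.hom_ext
    change ((F.map (r • f)).hom.rTensor V) = r • (F.map f).hom.rTensor V
    rw [F.map_smul, ModuleCat.hom_smul, LinearMap.rTensor_smul]

/-- The relative Hopf module `M ⊗ T` for a right `H`-comodule `T`. -/
noncomputable def tensorObj (M : RelHopfModule K H D) (T : ComodCat.{k, w} K H) :
    RelHopfModule K H D where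
  toMod := tensorMod M.toMod T.carrier
  comodule X := (M.comodule X).tensor T.str
  coact_map {X Y} f z :=
    RightComodule.tensor_coact_rTensor (M.comodule X) (M.comodule Y) T.str
      (modAction M.toMod X Y) (modAction (tensorMod M.toMod T.carrier) X Y)
      (fun _ _ _ => rfl) (M.toMod.map f).hom _ (M.coact_map f) z

/-- The functor `M ⊗ (-) : Comod-H ⥤ RelHopfModule`. -/
noncomputable def tensorFunctor (M : RelHopfModule K H D) :
    ComodCat.{k, w} K H ⥤ RelHopfModule K H D where
  obj T := M.tensorObj T
  map {T T'} φ :=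
    { nat :=
        { app := fun X => ModuleCat.ofHom (φ.lin.lTensor (M.toMod.obj X))
          naturality := fun X Y f => by
            apply ModuleCat.hom_ext
            exact TensorProduct.ext' fun m t => rfl }
      colinear := fun X z => RightComodule.tensor_coact_lTensor (M.comodule X) T.str T'.str
        φ.lin φ.colinear z }
  map_id T := by
    apply Hom.ext
    ext X : 3
    exact TensorProduct.ext' fun m t => rfl
  map_comp f g := by
    apply Hom.ext
    ext X : 3
    exact TensorProduct.ext' fun m t => rfl

/-- Evaluation `M(X) × Hom_{D-Mod}(M, N) → N(X)`, `(m, η) ↦ η(X)(m)`, as a bilinear map. -/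
noncomputable def ev (M N : RelHopfModule K H D) (X : D) :
    M.toMod.obj X →ₗ[K] M.DHom N →ₗ[K] N.toMod.obj X :=
  ((ModuleCat.homLinearEquiv (S := K)).toLinearMap ∘ₗ NatTrans.appLinearMap X).flip

theorem ev_naturality (M N : RelHopfModule K H D) {X Y : D} (f : X ⟶ Y) (m : M.toMod.obj X)
    (η : M.DHom N) : M.ev N Y (M.toMod.map f m) η = N.toMod.map f (M.ev N X m η) :=
  LinearMap.congr_fun (congrArg ModuleCat.Hom.hom (η.naturality f)) m

/-- The subspace of `Hom_{D-Mod}(M, N) ⊗ H` of all `∑ ηᵢ ⊗ hᵢ` such that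
`∑ ηᵢ(m)₀ ⊗ ηᵢ(m)₁ ⊗ hᵢ = ∑ ηᵢ(m₀) ⊗ m₁ hᵢ₁ ⊗ hᵢ₂` for all `m`. It carries the value at `N`
of a right adjoint of `M ⊗ (-)` and serves to show that this right adjoint exists. -/
noncomputable def homSpace (M N : RelHopfModule K H D) : Submodule K (M.DHom N ⊗[K] H) where
  carrier := {z | ∀ (X : D) (m : M.toMod.obj X),
    ((N.comodule X).coact ∘ₗ M.ev N X m).rTensor H z =
      (pairCoact K H (M.ev N X) ((M.comodule X).coact m)).rTensor H
        ((RightComodule.cofree (M.DHom N)).coact z)}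
  add_mem' hy hz X m := by simp only [map_add, hy X m, hz X m]
  zero_mem' X m := by simp only [map_zero]
  smul_mem' r z hz X m := by simp only [map_smul, hz X m]

theorem homSpace_coact_mem (M N : RelHopfModule K H D) (z : M.DHom N ⊗[K] H)
    (hz : z ∈ M.homSpace N) : (RightComodule.cofree (M.DHom N)).coact z ∈
      LinearMap.range ((M.homSpace N).subtype.rTensor H) := by
  have slice : ∀ {V W : Type w} [AddCommGroup V] [Module K V] [AddCommGroup W] [Module K W]
      (f : V →ₗ[K] W) (φ : H →ₗ[K] K) (y : V ⊗[K] H),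
      f (TensorProduct.rid K V (φ.lTensor V y)) =
        TensorProduct.rid K W (φ.lTensor W (f.rTensor H y)) := by
    intro V W _ _ _ _ f φ y
    induction y with
    | zero => simp
    | add y y' hy hy' => simp only [map_add, hy, hy']
    | tmul x p => simp
  apply mem_range_rTensor_subtype
  intro φ X m
  let f := (N.comodule X).coact ∘ₗ M.ev N X m
  let g := pairCoact K H (M.ev N X) ((M.comodule X).coact m)
  let δ := (RightComodule.cofree (K := K) (H := H) (M.DHom N)).coact
  change f.rTensor H _ = (g.rTensor H ∘ₗ δ) _
  rw [slice, slice]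
  congr 2
  change (f.rTensor H).rTensor H (δ z) = (g.rTensor H ∘ₗ δ).rTensor H (δ z)
  rw [LinearMap.rTensor_comp_apply, ← RightComodule.cofree_coact_coact,
    ← RightComodule.cofree_coact_rTensor, ← RightComodule.cofree_coact_rTensor]
  exact congrArg _ (hz X m)

/-- The comodule carried by `homSpace`. -/
noncomputable def homComod (M N : RelHopfModule K H D) : ComodCat.{k, w} K H where
  carrier := M.homSpace N
  str := (RightComodule.cofree (M.DHom N)).restrict _ (M.homSpace_coact_mem N)

/-- The component `M(X) ⊗ T → N(X)` of a morphism `M ⊗ T → N` of `D`-modules. -/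
noncomputable def tensorComp {M N : RelHopfModule K H D} {T : ComodCat.{k, w} K H}
    (φ : (M.tensorObj T).DHom N) (X : D) : M.toMod.obj X ⊗[K] T.carrier →ₗ[K] N.toMod.obj X :=
  (φ.app X).hom

/-- `t ↦ (m ↦ φ(m ⊗ t))` for a morphism `φ : M ⊗ T → N` of `D`-modules. -/
noncomputable def curryHom {M N : RelHopfModule K H D} {T : ComodCat.{k, w} K H}
    (φ : (M.tensorObj T).DHom N) : T.carrier →ₗ[K] M.DHom N where
  toFun t :=
    { app := fun X => ModuleCat.ofHom (tensorComp φ X ∘ₗ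
        (TensorProduct.mk K (M.toMod.obj X) T.carrier).flip t)
      naturality := fun X Y f => by
        ext m
        exact LinearMap.congr_fun (congrArg ModuleCat.Hom.hom (φ.naturality f)) (m ⊗ₜ[K] t) }
  map_add' t t' := by
    ext X m
    exact (congrArg (tensorComp φ X) (TensorProduct.tmul_add m t t')).trans
      (map_add (tensorComp φ X) _ _)
  map_smul' r t := by
    ext X m
    exact (congrArg (tensorComp φ X) (TensorProduct.tmul_smul r m t)).trans
      (map_smul (tensorComp φ X) _ _)

/-- `m ⊗ t ↦ θ(t)(m)` for a linear map `θ : T → Hom_{D-Mod}(M, N)`. -/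
noncomputable def uncurryHom {M N : RelHopfModule K H D} {T : ComodCat.{k, w} K H}
    (θ : T.carrier →ₗ[K] M.DHom N) : (M.tensorObj T).DHom N where
  app X := ModuleCat.ofHom (TensorProduct.lift ((M.ev N X).compl₂ θ))
  naturality X Y f := by
    apply ModuleCat.hom_ext
    exact TensorProduct.ext' fun m t => M.ev_naturality N f m (θ t)

theorem pairCoact_ev_rTensor {M N : RelHopfModule K H D} {T : ComodCat.{k, w} K H}
    (φ : (M.tensorObj T).DHom N) (X : D) (a : M.toMod.obj X ⊗[K] H)
    (b : T.carrier ⊗[K] H) :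
    pairCoact K H (M.ev N X) a ((curryHom φ).rTensor H b) =
      (tensorComp φ X).rTensor H
        (pairCoact K H (TensorProduct.mk K (M.toMod.obj X) T.carrier) a b) := by
  induction a with
  | zero => simp
  | add a a' ha ha' => simp only [map_add, LinearMap.add_apply, ha, ha']
  | tmul m q =>
    induction b with
    | zero => simp
    | add b b' hb hb' => simp only [map_add, hb, hb']
    | tmul t r => rfl

/-- `φ : M ⊗ T → N` is colinear iff the associated map `T → Hom_{D-Mod}(M, N)` satisfies the
corresponding identity. -/
theorem colinear_iff {M N : RelHopfModule K H D} {T : ComodCat.{k, w} K H}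
    (φ : (M.tensorObj T).DHom N) (X : D) :
    (∀ z : M.toMod.obj X ⊗[K] T.carrier, (N.comodule X).coact (tensorComp φ X z) =
      (tensorComp φ X).rTensor H (((M.comodule X).tensor T.str).coact z)) ↔
    ∀ (m : M.toMod.obj X) (t : T.carrier),
      (N.comodule X).coact (M.ev N X m (curryHom φ t)) =
      pairCoact K H (M.ev N X) ((M.comodule X).coact m)
        ((curryHom φ).rTensor H (T.str.coact t)) := by
  have e : ∀ (m : M.toMod.obj X) (t : T.carrier),
      M.ev N X m (curryHom φ t) = tensorComp φ X (m ⊗ₜ t) := fun _ _ => rfl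
  constructor
  · intro h m t
    rw [pairCoact_ev_rTensor, ← RightComodule.tensor_coact_tmul, ← h, e]
  · intro h z
    induction z with
    | zero => simp
    | add z z' hz hz' => simp only [map_add, hz, hz']
    | tmul m t => rw [← e, h, pairCoact_ev_rTensor, RightComodule.tensor_coact_tmul]

theorem curryHom_uncurryHom {M N : RelHopfModule K H D} {T : ComodCat.{k, w} K H}
    (θ : T.carrier →ₗ[K] M.DHom N) : curryHom (uncurryHom θ) = θ := by
  ext t X m
  rfl

theorem uncurryHom_curryHom {M N : RelHopfModule K H D} {T : ComodCat.{k, w} K H}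
    (φ : (M.tensorObj T).DHom N) : uncurryHom (curryHom φ) = φ := by
  ext X : 3
  exact TensorProduct.ext' fun m t => rfl

theorem homComod_coact (M N : RelHopfModule K H D) (z : M.homSpace N) :
    (M.homSpace N).subtype.rTensor H ((M.homComod N).str.coact z) =
      (RightComodule.cofree (M.DHom N)).coact (z : M.DHom N ⊗[K] H) :=
  RightComodule.restrict_coact _ _ (M.homSpace_coact_mem N) z

/-- The map `T → homComod M N` associated with `φ : M ⊗ T → N`. -/
noncomputable def toHomComod {M N : RelHopfModule K H D} {T : ComodCat.{k, w} K H}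
    (φ : M.tensorObj T ⟶ N) : T ⟶ M.homComod N where
  lin := ((curryHom φ.nat).rTensor H ∘ₗ T.str.coact).codRestrict (M.homSpace N) (by
    intro t X m
    have h : ((N.comodule X).coact ∘ₗ M.ev N X m) ∘ₗ curryHom φ.nat =
        pairCoact K H (M.ev N X) ((M.comodule X).coact m) ∘ₗ
          ((curryHom φ.nat).rTensor H ∘ₗ T.str.coact) :=
      LinearMap.ext fun t => (colinear_iff φ.nat X).1 (φ.colinear X) m t
    rw [LinearMap.comp_apply, ← LinearMap.rTensor_comp_apply, h,
      RightComodule.cofree_coact_rTensor, RightComodule.cofree_coact_coact]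
    simp only [LinearMap.rTensor_comp_apply])
  colinear t := by
    apply rTensor_subtype_injective H (M.homSpace N)
    refine (M.homComod_coact N _).trans ?_
    refine Eq.trans ?_ (LinearMap.rTensor_comp_apply H (M.homSpace N).subtype _ (T.str.coact t))
    change (RightComodule.cofree (M.DHom N)).coact
      ((curryHom φ.nat).rTensor H (T.str.coact t)) =
      ((curryHom φ.nat).rTensor H ∘ₗ T.str.coact).rTensor H (T.str.coact t)
    rw [RightComodule.cofree_coact_rTensor, RightComodule.cofree_coact_coact,
      LinearMap.rTensor_comp_apply]

/-- The map `T → Hom_{D-Mod}(M, N)` associated with `ψ : T → homComod M N`. -/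
noncomputable def homComodLin {M N : RelHopfModule K H D} {T : ComodCat.{k, w} K H}
    (ψ : T ⟶ M.homComod N) : T.carrier →ₗ[K] M.DHom N :=
  idCounit K H (M.DHom N) ∘ₗ (M.homSpace N).subtype ∘ₗ ψ.lin

theorem homComodLin_rTensor {M N : RelHopfModule K H D} {T : ComodCat.{k, w} K H}
    (ψ : T ⟶ M.homComod N) (t : T.carrier) :
    (homComodLin ψ).rTensor H (T.str.coact t) =
      ((M.homSpace N).subtype (ψ.lin t) : M.DHom N ⊗[K] H) := by
  refine (LinearMap.rTensor_comp_apply H (idCounit K H (M.DHom N))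
    ((M.homSpace N).subtype ∘ₗ ψ.lin) (T.str.coact t)).trans ?_
  refine Eq.trans (congrArg _ ?_) (rTensor_idCounit_cofree _)
  refine (LinearMap.rTensor_comp_apply H (M.homSpace N).subtype ψ.lin (T.str.coact t)).trans ?_
  refine Eq.trans ?_ (M.homComod_coact N _)
  exact congrArg _ (ψ.colinear t).symm

/-- The bijection `Hom(M ⊗ T, N) ≃ Hom_{Comod-H}(T, homComod M N)`. -/
noncomputable def homComodEquiv (M : RelHopfModule K H D) (T : ComodCat.{k, w} K H)
    (N : RelHopfModule K H D) : (M.tensorFunctor.obj T ⟶ N) ≃ (T ⟶ M.homComod N) where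
  toFun φ := toHomComod φ
  invFun ψ :=
    { nat := uncurryHom (homComodLin ψ)
      colinear := fun X => (colinear_iff _ X).2 fun m t => by
        rw [curryHom_uncurryHom, homComodLin_rTensor]
        have h := congrArg (idCounit K H _) ((ψ.lin t).2 X m)
        rw [idCounit_rTensor, idCounit_rTensor] at h
        refine Eq.trans h (congrArg _ ?_)
        exact (RightComodule.cofree (M.DHom N)).counit _ }
  left_inv φ := by
    apply Hom.ext
    refine Eq.trans (congrArg uncurryHom ?_) (uncurryHom_curryHom φ.nat)
    ext1 t
    change idCounit K H (M.DHom N) ((curryHom φ.nat).rTensor H (T.str.coact t)) = _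
    rw [idCounit_rTensor]
    exact congrArg _ (T.str.counit t)
  right_inv ψ := by
    apply ComodCat.Hom.ext
    ext1 t
    apply Subtype.ext
    exact homComodLin_rTensor ψ t

/-- `M ⊗ (-) : Comod-H ⥤ RelHopfModule` has a right adjoint. -/
instance (M : RelHopfModule K H D) : M.tensorFunctor.IsLeftAdjoint :=
  (Adjunction.adjunctionOfEquivRight M.homComodEquiv (by
    intro T' T N f φ
    apply ComodCat.Hom.ext
    ext1 t
    apply Subtype.ext
    change (curryHom φ.nat ∘ₗ f.lin).rTensor H (T'.str.coact t) =
      (curryHom φ.nat).rTensor H (T.str.coact (f.lin t))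
    rw [LinearMap.rTensor_comp_apply, f.colinear])).isLeftAdjoint

/-- The rational Hom object: `HOM_{D-Mod}(M, -) : RelHopfModule ⥤ Comod-H` is the right adjoint
of `M ⊗ (-) : Comod-H ⥤ RelHopfModule`. -/
noncomputable def HOM (M : RelHopfModule K H D) :
    RelHopfModule K H D ⥤ ComodCat.{k, w} K H :=
  M.tensorFunctor.rightAdjoint

/-- The adjunction `Hom(M ⊗ T, N) ≃ Hom_{Comod-H}(T, HOM_{D-Mod}(M, N))`. -/
noncomputable def HOMAdj (M : RelHopfModule K H D) : M.tensorFunctor ⊣ M.HOM :=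
  Adjunction.ofIsLeftAdjoint M.tensorFunctor

/-- Given a family of coactions `ρ N` on the spaces `Hom_{D-Mod}(M, N)` for which composition with
every morphism `g : N → N'` of relative Hopf modules is colinear, the functor
`Hom_{D-Mod}(M, -) : RelHopfModule ⥤ Comod-H`. -/
noncomputable def homFunctor (M : RelHopfModule K H D)
    (ρ : ∀ N : RelHopfModule K H D, RightComodule K H (M.DHom N))
    (hρ : ∀ (N N' : RelHopfModule K H D) (g : N ⟶ N') (η : M.DHom N),
      (ρ N').coact (η ≫ g.nat) = (Linear.rightComp K M.toMod g.nat).rTensor H ((ρ N).coact η)) :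
    RelHopfModule K H D ⥤ ComodCat.{k, w} K H where
  obj N := { carrier := M.DHom N, str := ρ N }
  map {N N'} g := { lin := Linear.rightComp K M.toMod g.nat, colinear := hρ N N' g }
  map_id N := by
    apply ComodCat.Hom.ext
    ext1 η
    exact Category.comp_id η
  map_comp f g := by
    apply ComodCat.Hom.ext
    ext1 η
    exact (Category.assoc η f.nat g.nat).symm

/-- For a `D`-module morphism `η : M → N`, not necessarily colinear, the linear map
`M(X) → N(X) ⊗ H`, `m ↦ ∑ η(m₀)₀ ⊗ S⁻¹(m₁) η(m₀)₁`. -/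
noncomputable def twistedCoact (hS : Function.Bijective (HopfAlgebra.antipode K (A := H)))
    {M N : RelHopfModule K H D} (η : M.DHom N) (X : D) :
    M.toMod.obj X →ₗ[K] N.toMod.obj X ⊗[K] H :=
  (TensorProduct.lift
    ((LinearMap.mul K H).flip.compl₂
      (LinearEquiv.ofBijective (HopfAlgebra.antipode K (A := H)) hS).symm.toLinearMap)).lTensor
      (N.toMod.obj X)
    ∘ₗ (TensorProduct.assoc K (N.toMod.obj X) H H).toLinearMap
    ∘ₗ ((N.comodule X).coact ∘ₗ (η.app X).hom).rTensor H
    ∘ₗ (M.comodule X).coact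

end RelHopfModule
end CoHCategories

/-! Call z = ∑ η₀ ⊗ η₁ a coaction of η when ρ(η(m)) = ∑ η₀(m₀) ⊗ m₁η₁ for all m (`IsCoactOf`). This
is the antipode-free form of the required formula. To pass between the two, let
`RightComodule.twist` send a linear map g : V → W ⊗ H on a comodule V to v ↦ ∑ φ(v₁)g(v₀). The
twists by id and by S⁻¹ are mutually inverse, because ∑ S⁻¹(h₂)h₁ = ε(h) = ∑ h₂S⁻¹(h₁). Hence z is a
coaction of η exactly when ∑ η₀(m) ⊗ η₁ is the twisted map of the statement
(`isCoactOf_iff_twistedCoact`). In particular z is unique, since evaluations separate the points of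
Hom(M, N) ⊗ H.

Existence needs two facts. The twisted map M → N ⊗ H is D-linear (`twistedCoact_map`). For finitely
generated M, every D-linear map M → N ⊗ H comes from Hom(M, N) ⊗ H (`exists_evTensor_eq`): the
values on finitely many generators involve only finitely many basis vectors of H.

The comodule axioms are inherited rather than checked. The coactions z are exactly the elements of
the comodule `homSpace`, so id ⊗ ε : `homSpace` → Hom(M, N) is bijective for finitely generated M,
and the structure is transported along it. Finally, by uniqueness of coactions, a D-linear map M ⊗ T
→ N is colinear exactly when the curried map T → Hom(M, N) is. Ordinary currying thus makes Hom(M,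
-) right adjoint to M ⊗ (-), with evaluation as counit, and uniqueness of adjoints gives the
comparison with `HOM`. -/

section TwistedMaps

/-! ### Left multiplication on W ⊗ H and its compatibility with pairings -/

variable {K : Type k} [Field K] {H : Type w} [Ring H] [HopfAlgebra K H]

/-- The left multiplication of `H` on the second factor of `W ⊗ H`. -/
noncomputable def lmulTensor (K : Type k) [Field K] (H : Type w) [Ring H] [HopfAlgebra K H]
    (W : Type*) [AddCommGroup W] [Module K W] :
    H →ₗ[K] W ⊗[K] H →ₗ[K] W ⊗[K] H :=
  LinearMap.lTensorHom W ∘ₗ LinearMap.mul K H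

@[simp]
theorem lmulTensor_tmul {W : Type*} [AddCommGroup W] [Module K W] (a b : H) (x : W) :
    lmulTensor K H W a (x ⊗ₜ b) = x ⊗ₜ (a * b) := rfl

theorem lmulTensor_one {W : Type*} [AddCommGroup W] [Module K W] (z : W ⊗[K] H) :
    lmulTensor K H W 1 z = z := by
  induction z with
  | zero => simp
  | add z z' hz hz' => simp only [map_add, hz, hz']
  | tmul x b => simp

theorem lmulTensor_mul {W : Type*} [AddCommGroup W] [Module K W] (a b : H) (z : W ⊗[K] H) :
    lmulTensor K H W (a * b) z = lmulTensor K H W a (lmulTensor K H W b z) := by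
  induction z with
  | zero => simp
  | add z z' hz hz' => simp only [map_add, hz, hz']
  | tmul x c => simp [mul_assoc]

theorem rTensor_lmulTensor {W W' : Type*} [AddCommGroup W] [Module K W] [AddCommGroup W']
    [Module K W'] (f : W →ₗ[K] W') (a : H) (z : W ⊗[K] H) :
    f.rTensor H (lmulTensor K H W a z) = lmulTensor K H W' a (f.rTensor H z) := by
  induction z with
  | zero => simp
  | add z z' hz hz' => simp only [map_add, hz, hz']
  | tmul x c => simp

theorem pairCoact_tmul_lmulTensor {U V W : Type*} [AddCommGroup U] [Module K U] [AddCommGroup V]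
    [Module K V] [AddCommGroup W] [Module K W] (b : U →ₗ[K] V →ₗ[K] W) (u : U) (p q : H)
    (z : V ⊗[K] H) : pairCoact K H b (u ⊗ₜ p) (lmulTensor K H V q z) =
      lmulTensor K H W (p * q) ((b u).rTensor H z) := by
  induction z with
  | zero => simp
  | add z z' hz hz' => simp only [map_add, hz, hz']
  | tmul x c => simp [pairCoact, mul_assoc]

theorem pairCoact_tmul {U V W : Type*} [AddCommGroup U] [Module K U] [AddCommGroup V]
    [Module K V] [AddCommGroup W] [Module K W] (b : U →ₗ[K] V →ₗ[K] W) (u : U) (p : H)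
    (z : V ⊗[K] H) : pairCoact K H b (u ⊗ₜ p) z = lmulTensor K H W p ((b u).rTensor H z) := by
  rw [← lmulTensor_one z, pairCoact_tmul_lmulTensor, mul_one, lmulTensor_one]

/-- Multiplicativity of ε. -/
theorem idCounit_pairCoact {U V W : Type*} [AddCommGroup U] [Module K U] [AddCommGroup V]
    [Module K V] [AddCommGroup W] [Module K W] (b : U →ₗ[K] V →ₗ[K] W)
    (x : U ⊗[K] H) (y : V ⊗[K] H) :
    idCounit K H W (pairCoact K H b x y) = b (idCounit K H U x) (idCounit K H V y) := by
  induction x with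
  | zero => simp
  | add x x' hx hx' => simp only [map_add, LinearMap.add_apply, hx, hx']
  | tmul u p =>
    induction y with
    | zero => simp
    | add y y' hy hy' => simp only [map_add, hy, hy']
    | tmul v q => simp [idCounit, pairCoact, smul_smul, mul_comm]

/-! ### Twisting a map V → W ⊗ H by the coaction of V -/

/-- `v ⊗ h ↦ φ(h) g(v)`. -/
noncomputable def twistLift {V W : Type*} [AddCommGroup V] [Module K V] [AddCommGroup W]
    [Module K W] (φ : H →ₗ[K] H) (g : V →ₗ[K] W ⊗[K] H) : V ⊗[K] H →ₗ[K] W ⊗[K] H :=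
  TensorProduct.lift ((lmulTensor K H W ∘ₗ φ).flip ∘ₗ g)

@[simp]
theorem twistLift_tmul {V W : Type*} [AddCommGroup V] [Module K V] [AddCommGroup W]
    [Module K W] (φ : H →ₗ[K] H) (g : V →ₗ[K] W ⊗[K] H) (x : V) (h : H) :
    twistLift φ g (x ⊗ₜ h) = lmulTensor K H W (φ h) (g x) := rfl

theorem twistLift_comp {U V W : Type*} [AddCommGroup U] [Module K U] [AddCommGroup V] [Module K V]
    [AddCommGroup W] [Module K W] (φ : H →ₗ[K] H) (g : V →ₗ[K] W ⊗[K] H) (u : U →ₗ[K] V)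
    (z : U ⊗[K] H) : twistLift φ (g ∘ₗ u) z = twistLift φ g (u.rTensor H z) := by
  induction z with
  | zero => simp
  | add z z' hz hz' => simp only [map_add, hz, hz']
  | tmul x h => simp

theorem twistLift_rTensor {V W W' : Type*} [AddCommGroup V] [Module K V]
    [AddCommGroup W] [Module K W] [AddCommGroup W'] [Module K W'] (φ : H →ₗ[K] H)
    (g : V →ₗ[K] W ⊗[K] H) (f : W →ₗ[K] W') (z : V ⊗[K] H) :
    twistLift φ (f.rTensor H ∘ₗ g) z = f.rTensor H (twistLift φ g z) := by
  induction z with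
  | zero => simp
  | add z z' hz hz' => simp only [map_add, hz, hz']
  | tmul x h => simp [rTensor_lmulTensor]

theorem twistLift_rTensorHom {U V W : Type*} [AddCommGroup U] [Module K U] [AddCommGroup V]
    [Module K V] [AddCommGroup W] [Module K W] (b : U →ₗ[K] V →ₗ[K] W) (x : U ⊗[K] H)
    (z : V ⊗[K] H) :
    twistLift LinearMap.id ((LinearMap.rTensorHom H ∘ₗ b).flip z) x = pairCoact K H b x z := by
  induction x with
  | zero => simp
  | add x x' hx hx' => simp only [map_add, LinearMap.add_apply, hx, hx']
  | tmul u h => simp [pairCoact_tmul]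

theorem RightComodule.cofree_coact_tmul {V : Type*} [AddCommGroup V] [Module K V] (x : V)
    (h : H) : (RightComodule.cofree V).coact (x ⊗ₜ[K] h) =
      (TensorProduct.assoc K V H H).symm (x ⊗ₜ Coalgebra.comul h) := rfl

/-- Multiplicativity of Δ, in the form used to show that coactions lie in `homSpace`. -/
theorem pairCoact_cofree_coact {U V W : Type*} [AddCommGroup U] [Module K U] [AddCommGroup V]
    [Module K V] [AddCommGroup W] [Module K W] (b : U →ₗ[K] V →ₗ[K] W) (x : U ⊗[K] H)
    (z : V ⊗[K] H) :
    pairCoact K H (pairCoact K H b) ((RightComodule.cofree U).coact x)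
      ((RightComodule.cofree V).coact z) =
      (RightComodule.cofree W).coact (pairCoact K H b x z) := by
  have key : ∀ (u : U) (v : V) (p q : H ⊗[K] H), pairCoact K H (pairCoact K H b)
      ((TensorProduct.assoc K U H H).symm (u ⊗ₜ p))
      ((TensorProduct.assoc K V H H).symm (v ⊗ₜ q)) =
      (TensorProduct.assoc K W H H).symm (b u v ⊗ₜ (p * q)) := by
    intro u v p q
    induction p with
    | zero => simp
    | add p p' hp hp' =>
      simp only [map_add, LinearMap.add_apply, TensorProduct.tmul_add, add_mul, hp, hp']
    | tmul p₁ p₂ =>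
      induction q with
      | zero => simp
      | add q q' hq hq' => simp only [map_add, TensorProduct.tmul_add, mul_add, hq, hq']
      | tmul q₁ q₂ => simp [pairCoact]
  induction x with
  | zero => simp
  | add x x' hx hx' => simp only [map_add, LinearMap.add_apply, hx, hx']
  | tmul u p =>
    induction z with
    | zero => simp
    | add z z' hz hz' => simp only [map_add, hz, hz']
    | tmul v q =>
      have e : pairCoact K H b (u ⊗ₜ p) (v ⊗ₜ q) = b u v ⊗ₜ (p * q) := rfl
      rw [e, RightComodule.cofree_coact_tmul, RightComodule.cofree_coact_tmul, key,
        RightComodule.cofree_coact_tmul, Bialgebra.comul_mul]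

/-- For a linear map `g : V → W ⊗ H` on a right `H`-comodule `V`, the linear map
`v ↦ ∑ φ(v₁) g(v₀)`. -/
noncomputable def RightComodule.twist {V W : Type*} [AddCommGroup V] [Module K V] [AddCommGroup W]
    [Module K W] (c : RightComodule K H V) (φ : H →ₗ[K] H) (g : V →ₗ[K] W ⊗[K] H) :
    V →ₗ[K] W ⊗[K] H :=
  twistLift φ g ∘ₗ c.coact

theorem RightComodule.twist_apply {V W : Type*} [AddCommGroup V] [Module K V] [AddCommGroup W]
    [Module K W] (c : RightComodule K H V) (φ : H →ₗ[K] H) (g : V →ₗ[K] W ⊗[K] H) (x : V) :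
    c.twist φ g x = twistLift φ g (c.coact x) := rfl

theorem RightComodule.twist_rTensor {V W W' : Type*} [AddCommGroup V] [Module K V]
    [AddCommGroup W] [Module K W] [AddCommGroup W'] [Module K W'] (c : RightComodule K H V)
    (φ : H →ₗ[K] H) (g : V →ₗ[K] W ⊗[K] H) (f : W →ₗ[K] W') :
    c.twist φ (f.rTensor H ∘ₗ g) = f.rTensor H ∘ₗ c.twist φ g :=
  LinearMap.ext fun _ => twistLift_rTensor φ g f _

theorem RightComodule.twist_comp {U V W : Type*} [AddCommGroup U] [Module K U] [AddCommGroup V]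
    [Module K V] [AddCommGroup W] [Module K W] (d : RightComodule K H U) (c : RightComodule K H V)
    (φ : H →ₗ[K] H) (g : V →ₗ[K] W ⊗[K] H) (u : U →ₗ[K] V)
    (hu : ∀ x, c.coact (u x) = u.rTensor H (d.coact x)) :
    d.twist φ (g ∘ₗ u) = c.twist φ g ∘ₗ u := by
  ext x
  rw [twist_apply, twistLift_comp, ← hu, LinearMap.comp_apply, twist_apply]

/-- By coassociativity of the coaction, both sides are v ↦ ∑ φ(v₂)ψ(v₁)g(v₀). Twists therefore
compose by the convolution product with the order of the factors reversed, which is why S⁻¹ and not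
S inverts the twist by id. -/
theorem RightComodule.twist_twist {V W : Type*} [AddCommGroup V] [Module K V] [AddCommGroup W]
    [Module K W] (c : RightComodule K H V) (φ ψ : H →ₗ[K] H) (g : V →ₗ[K] W ⊗[K] H) :
    c.twist φ (c.twist ψ g) =
      c.twist (TensorProduct.lift ((LinearMap.mul K H).flip.compl₁₂ ψ φ) ∘ₗ
        Coalgebra.comul) g := by
  have key : ∀ y : (V ⊗[K] H) ⊗[K] H, twistLift φ (twistLift ψ g) y =
      twistLift LinearMap.id g
        ((TensorProduct.lift ((LinearMap.mul K H).flip.compl₁₂ ψ φ)).lTensor V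
          (TensorProduct.assoc K V H H y)) := by
    intro y
    induction y with
    | zero => simp
    | add y y' hy hy' => simp only [map_add, hy, hy']
    | tmul a q =>
      induction a with
      | zero => simp
      | add a a' ha ha' => simp only [map_add, TensorProduct.add_tmul, ha, ha']
      | tmul x p => simp [lmulTensor_mul]
  have key' : ∀ (χ : H →ₗ[K] H) (y : V ⊗[K] H),
      twistLift LinearMap.id g (χ.lTensor V y) = twistLift χ g y := by
    intro χ y
    induction y with
    | zero => simp
    | add y y' hy hy' => simp only [map_add, hy, hy']
    | tmul x p => simp
  ext x
  rw [twist_apply, twist, twistLift_comp, key, c.coassoc, ← LinearMap.lTensor_comp_apply, key',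
    twist_apply]

theorem RightComodule.twist_counit {V W : Type*} [AddCommGroup V] [Module K V] [AddCommGroup W]
    [Module K W] (c : RightComodule K H V) (g : V →ₗ[K] W ⊗[K] H) :
    c.twist (Algebra.linearMap K H ∘ₗ Coalgebra.counit) g = g := by
  have key : ∀ y : V ⊗[K] H, twistLift (Algebra.linearMap K H ∘ₗ Coalgebra.counit) g y =
      g (idCounit K H V y) := by
    intro y
    induction y with
    | zero => simp
    | add y y' hy hy' => simp only [map_add, hy, hy']
    | tmul x p => simp [idCounit, Algebra.algebraMap_eq_smul_one, lmulTensor_one]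
  ext x
  rw [twist_apply, key]
  exact congrArg g (c.counit x)

/-! ### The inverse antipode and the inversion of twists -/

/-- The inverse of a bijective antipode. -/
noncomputable def antipodeInv (hS : Function.Bijective (HopfAlgebra.antipode K (A := H))) :
    H →ₗ[K] H :=
  (LinearEquiv.ofBijective (HopfAlgebra.antipode K (A := H)) hS).symm.toLinearMap

theorem antipode_antipodeInv (hS : Function.Bijective (HopfAlgebra.antipode K (A := H))) (h : H) :
    HopfAlgebra.antipode K (antipodeInv hS h) = h :=
  (LinearEquiv.ofBijective (HopfAlgebra.antipode K (A := H)) hS).apply_symm_apply h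

/-- `∑ S⁻¹(h₂) h₁ = ε(h)`. -/
theorem antipodeInv_mul_comul (hS : Function.Bijective (HopfAlgebra.antipode K (A := H))) :
    TensorProduct.lift ((LinearMap.mul K H).flip.compl₁₂ LinearMap.id (antipodeInv hS)) ∘ₗ
      Coalgebra.comul = Algebra.linearMap K H ∘ₗ Coalgebra.counit := by
  -- S reverses products, so S(S⁻¹(h₂)h₁) = S(h₁)h₂; injectivity of S then reduces the claim to the
  -- antipode axiom.
  have key : HopfAlgebra.antipode K ∘ₗ
      TensorProduct.lift ((LinearMap.mul K H).flip.compl₁₂ LinearMap.id (antipodeInv hS)) =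
      LinearMap.mul' K H ∘ₗ (HopfAlgebra.antipode K).rTensor H := by
    apply TensorProduct.ext'
    intro a b
    simp [HopfAlgebra.antipode_mul_antidistrib, antipode_antipodeInv]
  ext h
  apply hS.1
  refine (LinearMap.congr_fun key (Coalgebra.comul h)).trans ?_
  simp [Algebra.algebraMap_eq_smul_one]

/-- `∑ h₂ S⁻¹(h₁) = ε(h)`. -/
theorem mul_antipodeInv_comul (hS : Function.Bijective (HopfAlgebra.antipode K (A := H))) :
    TensorProduct.lift ((LinearMap.mul K H).flip.compl₁₂ (antipodeInv hS) LinearMap.id) ∘ₗ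
      Coalgebra.comul = Algebra.linearMap K H ∘ₗ Coalgebra.counit := by
  -- Likewise S(h₂S⁻¹(h₁)) = h₁S(h₂).
  have key : HopfAlgebra.antipode K ∘ₗ
      TensorProduct.lift ((LinearMap.mul K H).flip.compl₁₂ (antipodeInv hS) LinearMap.id) =
      LinearMap.mul' K H ∘ₗ (HopfAlgebra.antipode K).lTensor H := by
    apply TensorProduct.ext'
    intro a b
    simp [HopfAlgebra.antipode_mul_antidistrib, antipode_antipodeInv]
  ext h
  apply hS.1
  refine (LinearMap.congr_fun key (Coalgebra.comul h)).trans ?_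
  simp [Algebra.algebraMap_eq_smul_one]

theorem RightComodule.twist_antipodeInv_twist
    (hS : Function.Bijective (HopfAlgebra.antipode K (A := H)))
    {V W : Type*} [AddCommGroup V] [Module K V] [AddCommGroup W]
    [Module K W] (c : RightComodule K H V) (g : V →ₗ[K] W ⊗[K] H) :
    c.twist (antipodeInv hS) (c.twist LinearMap.id g) = g := by
  rw [twist_twist, antipodeInv_mul_comul, twist_counit]

theorem RightComodule.twist_twist_antipodeInv
    (hS : Function.Bijective (HopfAlgebra.antipode K (A := H)))
    {V W : Type*} [AddCommGroup V] [Module K V] [AddCommGroup W]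
    [Module K W] (c : RightComodule K H V) (g : V →ₗ[K] W ⊗[K] H) :
    c.twist LinearMap.id (c.twist (antipodeInv hS) g) = g := by
  rw [twist_twist, mul_antipodeInv_comul, twist_counit]

/-- This lets identities between maps into W ⊗ H be verified after twisting by id, where S⁻¹ no
longer occurs. -/
theorem RightComodule.twist_id_injective
    (hS : Function.Bijective (HopfAlgebra.antipode K (A := H)))
    {V W : Type*} [AddCommGroup V] [Module K V] [AddCommGroup W]
    [Module K W] (c : RightComodule K H V) :
    Function.Injective (c.twist (W := W) LinearMap.id) :=
  Function.LeftInverse.injective (c.twist_antipodeInv_twist hS)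

/-! ### Transport of comodule structures; separation of points after tensoring -/

/-- The comodule structure transported along a linear equivalence. -/
noncomputable def RightComodule.congr {V W : Type*} [AddCommGroup V] [Module K V]
    [AddCommGroup W] [Module K W] (c : RightComodule K H V) (e : V ≃ₗ[K] W) :
    RightComodule K H W where
  coact := e.toLinearMap.rTensor H ∘ₗ c.coact ∘ₗ e.symm.toLinearMap
  coassoc x := by
    have e1 : ∀ y : (V ⊗[K] H) ⊗[K] H, TensorProduct.assoc K W H H
        ((e.toLinearMap.rTensor H).rTensor H y) =
        e.toLinearMap.rTensor (H ⊗[K] H) (TensorProduct.assoc K V H H y) := by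
      intro y
      induction y with
      | zero => simp
      | add y y' hy hy' => simp only [map_add, hy, hy']
      | tmul a q =>
        induction a with
        | zero => simp
        | add a a' ha ha' => simp only [map_add, TensorProduct.add_tmul, ha, ha']
        | tmul x p => simp
    have e2 : (e.toLinearMap.rTensor H ∘ₗ c.coact ∘ₗ e.symm.toLinearMap) ∘ₗ e.toLinearMap =
        e.toLinearMap.rTensor H ∘ₗ c.coact := by
      ext x
      simp
    have e3 : ∀ y : V ⊗[K] H, (Coalgebra.comul (R := K) (A := H)).lTensor W
        (e.toLinearMap.rTensor H y) = e.toLinearMap.rTensor (H ⊗[K] H)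
          ((Coalgebra.comul (R := K) (A := H)).lTensor V y) := by
      intro y
      induction y with
      | zero => simp
      | add y y' hy hy' => simp only [map_add, hy, hy']
      | tmul a q => simp
    change TensorProduct.assoc K W H H (LinearMap.rTensor H _
      (e.toLinearMap.rTensor H (c.coact (e.symm x)))) = Coalgebra.comul.lTensor W
        (e.toLinearMap.rTensor H (c.coact (e.symm x)))
    rw [← LinearMap.rTensor_comp_apply, e2, LinearMap.rTensor_comp_apply, e1, c.coassoc, e3]
  counit x := by
    refine (idCounit_rTensor e.toLinearMap (c.coact (e.symm x))).trans ?_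
    exact (congrArg e (c.counit (e.symm x))).trans (e.apply_symm_apply x)

/-- A family of linear maps that separates the points of `V` separates, after tensoring with
`H`, the points of `V ⊗ H`. -/
theorem eq_of_forall_rTensor_eq {V ι : Type*} [AddCommGroup V] [Module K V] {W : ι → Type*}
    [∀ i, AddCommGroup (W i)] [∀ i, Module K (W i)] (f : ∀ i, V →ₗ[K] W i)
    (hf : ∀ x, (∀ i, f i x = 0) → x = 0) {z z' : V ⊗[K] H}
    (h : ∀ i, (f i).rTensor H z = (f i).rTensor H z') : z = z' := by
  classical
  let b := Module.Basis.ofVectorSpace K H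
  -- Coordinates with respect to a basis of H commute with `f i`, so separation can be applied to
  -- each coordinate.
  have hb : ∀ i j (y : V ⊗[K] H),
      TensorProduct.equivFinsuppOfBasisRight (M := W i) b ((f i).rTensor H y) j =
        f i (TensorProduct.equivFinsuppOfBasisRight (M := V) b y j) := by
    intro i j y
    induction y with
    | zero => simp
    | add y y' hy hy' => simp only [map_add, Finsupp.add_apply, hy, hy']
    | tmul x p => simp
  apply (TensorProduct.equivFinsuppOfBasisRight (M := V) b).injective
  ext j
  rw [← sub_eq_zero]
  apply hf
  intro i
  rw [map_sub, ← hb, ← hb, h, sub_self]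

end TwistedMaps

/-! ### Coactions of a single morphism: uniqueness and relation to `homSpace` -/

section CoHCategories

variable {K : Type k} [Field K] {H : Type w} [Ring H] [HopfAlgebra K H]
  {D : Type w} [Category.{v} D] [Preadditive D] [Linear K D] [CoHCategory K H D]

namespace RelHopfModule

/-- `z = ∑ η₀ ⊗ η₁` is a coaction of `η`: `ρ(η(m)) = ∑ η₀(m₀) ⊗ m₁ η₁` for all `m`. -/
def IsCoactOf {M N : RelHopfModule K H D} (z : M.DHom N ⊗[K] H) (η : M.DHom N) : Prop :=
  ∀ (X : D) (m : M.toMod.obj X), (N.comodule X).coact (M.ev N X m η) =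
    pairCoact K H (M.ev N X) ((M.comodule X).coact m) z

/-- `m ↦ ∑ ηᵢ(m) ⊗ hᵢ` for `z = ∑ ηᵢ ⊗ hᵢ`. -/
noncomputable def evTensor {M N : RelHopfModule K H D} (z : M.DHom N ⊗[K] H) (X : D) :
    M.toMod.obj X →ₗ[K] N.toMod.obj X ⊗[K] H :=
  (LinearMap.rTensorHom H ∘ₗ M.ev N X).flip z

theorem evTensor_apply {M N : RelHopfModule K H D} (z : M.DHom N ⊗[K] H) (X : D)
    (m : M.toMod.obj X) : evTensor z X m = (M.ev N X m).rTensor H z := rfl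

theorem twistLift_evTensor {M N : RelHopfModule K H D} (z : M.DHom N ⊗[K] H) (X : D)
    (y : M.toMod.obj X ⊗[K] H) :
    twistLift LinearMap.id (evTensor z X) y = pairCoact K H (M.ev N X) y z :=
  twistLift_rTensorHom (M.ev N X) y z

theorem twistedCoact_eq (hS : Function.Bijective (HopfAlgebra.antipode K (A := H)))
    {M N : RelHopfModule K H D} (η : M.DHom N) (X : D) :
    twistedCoact hS η X =
      (M.comodule X).twist (antipodeInv hS) ((N.comodule X).coact ∘ₗ (η.app X).hom) := by
  have key : ∀ (a : H) (u : N.toMod.obj X ⊗[K] H),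
      (TensorProduct.lift ((LinearMap.mul K H).flip.compl₂ (antipodeInv hS))).lTensor
        (N.toMod.obj X) (TensorProduct.assoc K (N.toMod.obj X) H H (u ⊗ₜ a)) =
      lmulTensor K H (N.toMod.obj X) (antipodeInv hS a) u := by
    intro a u
    induction u with
    | zero => simp
    | add u u' hu hu' => simp only [map_add, TensorProduct.add_tmul, hu, hu']
    | tmul x p => simp
  have key' : ∀ y : M.toMod.obj X ⊗[K] H,
      (TensorProduct.lift ((LinearMap.mul K H).flip.compl₂ (antipodeInv hS))).lTensor
        (N.toMod.obj X) (TensorProduct.assoc K (N.toMod.obj X) H H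
          (((N.comodule X).coact ∘ₗ (η.app X).hom).rTensor H y)) =
      twistLift (antipodeInv hS) ((N.comodule X).coact ∘ₗ (η.app X).hom) y := by
    intro y
    induction y with
    | zero => simp
    | add y y' hy hy' => simp only [map_add, hy, hy']
    | tmul m a => rw [LinearMap.rTensor_tmul, key, twistLift_tmul]
  exact LinearMap.ext fun m => key' _

theorem isCoactOf_iff_twist {M N : RelHopfModule K H D} (z : M.DHom N ⊗[K] H) (η : M.DHom N) :
    IsCoactOf z η ↔ ∀ X, (M.comodule X).twist LinearMap.id (evTensor z X) =
      (N.comodule X).coact ∘ₗ (η.app X).hom := by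
  refine forall_congr' fun X => ?_
  rw [LinearMap.ext_iff]
  refine forall_congr' fun m => ?_
  rw [RightComodule.twist_apply, twistLift_evTensor]
  exact eq_comm

/-- The right-hand side is the twist of ρ ∘ η by S⁻¹, and the twists by id and S⁻¹ are mutually
inverse. -/
theorem isCoactOf_iff_twistedCoact (hS : Function.Bijective (HopfAlgebra.antipode K (A := H)))
    {M N : RelHopfModule K H D} (z : M.DHom N ⊗[K] H) (η : M.DHom N) :
    IsCoactOf z η ↔ ∀ X, evTensor z X = twistedCoact hS η X := by
  rw [isCoactOf_iff_twist]
  refine forall_congr' fun X => ?_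
  rw [twistedCoact_eq]
  constructor
  · intro h
    rw [← h, RightComodule.twist_antipodeInv_twist]
  · intro h
    rw [h, RightComodule.twist_twist_antipodeInv]

theorem DHom.eq_zero_of_ev {M N : RelHopfModule K H D} (η : M.DHom N)
    (h : ∀ X m, M.ev N X m η = 0) : η = 0 := by
  ext X m
  exact h X m

theorem eq_of_evTensor_eq {M N : RelHopfModule K H D} {z z' : M.DHom N ⊗[K] H}
    (h : ∀ X m, evTensor z X m = evTensor z' X m) : z = z' :=
  eq_of_forall_rTensor_eq (fun p : Σ X : D, M.toMod.obj X => M.ev N p.1 p.2)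
    (fun η hη => DHom.eq_zero_of_ev η fun X m => hη ⟨X, m⟩) fun p => h p.1 p.2

theorem IsCoactOf.unique (hS : Function.Bijective (HopfAlgebra.antipode K (A := H)))
    {M N : RelHopfModule K H D} {z z' : M.DHom N ⊗[K] H} {η : M.DHom N} (h : IsCoactOf z η)
    (h' : IsCoactOf z' η) : z = z' := by
  rw [isCoactOf_iff_twistedCoact hS] at h h'
  refine eq_of_evTensor_eq fun X m => ?_
  rw [h, h']

/-- Apply id ⊗ ε to ρ(η(m)) = ∑ η₀(m₀) ⊗ m₁η₁ and use the counit axioms of N(X) and M(X). -/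
theorem IsCoactOf.idCounit_eq {M N : RelHopfModule K H D} {z : M.DHom N ⊗[K] H} {η : M.DHom N}
    (h : IsCoactOf z η) : idCounit K H (M.DHom N) z = η := by
  rw [← sub_eq_zero]
  refine DHom.eq_zero_of_ev _ fun X m => ?_
  have e := congrArg (idCounit K H _) (h X m)
  rw [idCounit_pairCoact] at e
  have e1 : idCounit K H _ ((N.comodule X).coact (M.ev N X m η)) = M.ev N X m η :=
    (N.comodule X).counit _
  have e2 : idCounit K H _ ((M.comodule X).coact m) = m := (M.comodule X).counit _
  rw [e1, e2] at e
  rw [map_sub, ← e, sub_self]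

/-- Apply ε to the last tensor factor of the identity defining `homSpace`. -/
theorem isCoactOf_of_mem_homSpace {M N : RelHopfModule K H D} {z : M.DHom N ⊗[K] H}
    (hz : z ∈ M.homSpace N) : IsCoactOf z (idCounit K H (M.DHom N) z) := by
  intro X m
  have h := congrArg (idCounit K H _) (hz X m)
  rw [idCounit_rTensor, idCounit_rTensor] at h
  refine Eq.trans h (congrArg _ ?_)
  exact (RightComodule.cofree (M.DHom N)).counit _

/-- The defining identity of `homSpace` holds after twisting by id: both sides then equal (id ⊗
Δ)ρ(η(m)), one by coassociativity in N(X), the other by coassociativity in M(X) and multiplicativity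
of Δ. -/
theorem IsCoactOf.mem_homSpace (hS : Function.Bijective (HopfAlgebra.antipode K (A := H)))
    {M N : RelHopfModule K H D} {z : M.DHom N ⊗[K] H} {η : M.DHom N} (h : IsCoactOf z η) :
    z ∈ M.homSpace N := by
  intro X m
  let ρM := (M.comodule X).coact
  let ρN := (N.comodule X).coact
  let δz := (RightComodule.cofree (M.DHom N)).coact z
  let G := (LinearMap.rTensorHom H ∘ₗ pairCoact K H (M.ev N X)).flip δz
  suffices e : ρN.rTensor H ∘ₗ evTensor z X = G ∘ₗ ρM by
    rw [LinearMap.rTensor_comp_apply]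
    exact LinearMap.congr_fun e m
  apply (M.comodule X).twist_id_injective hS
  rw [RightComodule.twist_rTensor, (isCoactOf_iff_twist z η).1 h X]
  ext m
  refine ((N.comodule X).cofree_coact_coact (M.ev N X m η)).symm.trans ?_
  rw [RightComodule.twist_apply, twistLift_comp, ← RightComodule.cofree_coact_coact,
    twistLift_rTensorHom, pairCoact_cofree_coact, h X m]

/-! ### Existence of coactions for finitely generated M -/

/-- For a finitely generated `M`, every morphism of `D`-modules `M → N ⊗ H` comes from an element
of `Hom_{D-Mod}(M, N) ⊗ H`. -/
theorem exists_evTensor_eq {M : RelHopfModule K H D} (hM : M.IsFinGen) {N : RelHopfModule K H D}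
    (τ : ∀ X : D, M.toMod.obj X →ₗ[K] N.toMod.obj X ⊗[K] H)
    (hτ : ∀ {X Y : D} (f : X ⟶ Y) (m : M.toMod.obj X),
      τ Y (M.toMod.map f m) = (N.toMod.map f).hom.rTensor H (τ X m)) :
    ∃ z : M.DHom N ⊗[K] H, ∀ X, evTensor z X = τ X := by
  classical
  obtain ⟨n, Y, g, hg⟩ := hM
  let b := Module.Basis.ofVectorSpace K H
  let E : ∀ X : D, N.toMod.obj X ⊗[K] H ≃ₗ[K] (_ →₀ N.toMod.obj X) :=
    fun X => TensorProduct.equivFinsuppOfBasisRight b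
  have hE : ∀ {X X' : D} (f : X ⟶ X') (y : N.toMod.obj X ⊗[K] H) j,
      E X' ((N.toMod.map f).hom.rTensor H y) j = N.toMod.map f (E X y j) := by
    intro X X' f y j
    induction y with
    | zero => simp
    | add y y' hy hy' => simp only [map_add, Finsupp.add_apply, hy, hy']
    | tmul x p => simp [E]
  -- The coordinates of τ along the basis of H are D-linear, because D acts only on the first factor
  -- of N ⊗ H.
  let η : ∀ _, M.DHom N := fun j =>
    { app := fun X => ModuleCat.ofHom
        (Finsupp.lapply j ∘ₗ (E X).toLinearMap ∘ₗ τ X)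
      naturality := fun X X' f => by
        ext m
        exact (congrArg (fun y => E X' y j) (hτ f m)).trans (hE f _ j) }
  have hη : ∀ j X m, M.ev N X m (η j) = E X (τ X m) j := fun _ _ _ => rfl
  -- The basis indices occurring in the values of τ on the generators. This set is finite because
  -- there are finitely many generators; for arbitrary m infinitely many coordinate maps could
  -- matter.
  let s := Finset.univ.biUnion fun i => (E (Y i) (τ (Y i) (g i))).support
  refine ⟨∑ j ∈ s, η j ⊗ₜ b j, fun X => LinearMap.ext fun m => ?_⟩
  have gen : ∀ i, evTensor (∑ j ∈ s, η j ⊗ₜ b j) (Y i) (g i) = τ (Y i) (g i) := by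
    intro i
    rw [evTensor_apply, map_sum]
    simp only [LinearMap.rTensor_tmul, hη]
    conv_rhs => rw [← (E (Y i)).symm_apply_apply (τ (Y i) (g i))]
    refine Eq.trans ?_
      (TensorProduct.equivFinsuppOfBasisRight_symm_apply b _).symm
    refine (Finset.sum_subset (Finset.subset_biUnion_of_mem
      (fun i => (E (Y i) (τ (Y i) (g i))).support) (Finset.mem_univ i)) ?_).symm
    intro j _ hj
    rw [Finsupp.notMem_support_iff.1 hj, TensorProduct.zero_tmul]
  have nat : ∀ (z : M.DHom N ⊗[K] H) {X X' : D} (f : X ⟶ X') (m : M.toMod.obj X),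
      evTensor z X' (M.toMod.map f m) = (N.toMod.map f).hom.rTensor H (evTensor z X m) := by
    intro z X X' f m
    rw [evTensor_apply, evTensor_apply, ← LinearMap.rTensor_comp_apply]
    congr 2
    ext η
    exact M.ev_naturality N f m η
  -- Two D-linear maps that agree on generators are equal.
  obtain ⟨f, rfl⟩ := hg X m
  rw [map_sum, map_sum]
  refine Finset.sum_congr rfl fun i _ => ?_
  rw [nat, gen, hτ]

/-- Both sides, as functions of f ⊗ m, are linear maps on the comodule Hom(X, Y) ⊗ M(X), so they may
be compared after twisting by id. Both twists become ρ(N(f)(η(m))), using the Hopf module axioms of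
M and N and the naturality of η. -/
theorem twistedCoact_map (hS : Function.Bijective (HopfAlgebra.antipode K (A := H)))
    {M N : RelHopfModule K H D} (η : M.DHom N) {X Y : D} (f : X ⟶ Y) (m : M.toMod.obj X) :
    twistedCoact hS η Y (M.toMod.map f m) =
      (N.toMod.map f).hom.rTensor H (twistedCoact hS η X m) := by
  let τ : ∀ X : D, M.toMod.obj X →ₗ[K] N.toMod.obj X ⊗[K] H := fun X => twistedCoact hS η X
  have hτ : ∀ X, (M.comodule X).twist LinearMap.id (τ X) =
      (N.comodule X).coact ∘ₗ (η.app X).hom := fun X => by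
    rw [← (M.comodule X).twist_twist_antipodeInv hS ((N.comodule X).coact ∘ₗ (η.app X).hom),
      ← twistedCoact_eq]
  let c := (CoHCategory.homComodule (K := K) (H := H) X Y).tensor (M.comodule X)
  let u : (X ⟶ Y) ⊗[K] M.toMod.obj X →ₗ[K] M.toMod.obj Y :=
    TensorProduct.lift (modAction M.toMod X Y)
  let β : (X ⟶ Y) ⊗[K] M.toMod.obj X →ₗ[K] N.toMod.obj Y ⊗[K] H :=
    TensorProduct.lift ((LinearMap.rTensorHom H ∘ₗ modAction N.toMod X Y).compl₂ (τ X))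
  -- The Hopf module axiom of M says precisely that the action map u is colinear, so twisting
  -- commutes with composition with u.
  have hu : ∀ x, (M.comodule Y).coact (u x) = u.rTensor H (c.coact x) := by
    have key : ∀ (x : (X ⟶ Y) ⊗[K] H) (y : M.toMod.obj X ⊗[K] H),
        u.rTensor H (pairCoact K H (TensorProduct.mk K (X ⟶ Y) (M.toMod.obj X)) x y) =
          pairCoact K H (modAction M.toMod X Y) x y := by
      intro x y
      induction x with
      | zero => simp
      | add x x' hx hx' => simp only [map_add, LinearMap.add_apply, hx, hx']
      | tmul f p =>
        induction y with
        | zero => simp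
        | add y y' hy hy' => simp only [map_add, hy, hy']
        | tmul m q => simp [pairCoact, u]
    intro x
    induction x with
    | zero => simp
    | add x x' hx hx' => simp only [map_add, hx, hx']
    | tmul f m =>
      rw [RightComodule.tensor_coact_tmul, key]
      exact M.coact_map f m
  have hβ : ∀ (x : (X ⟶ Y) ⊗[K] H) (y : M.toMod.obj X ⊗[K] H),
      twistLift LinearMap.id β
        (pairCoact K H (TensorProduct.mk K (X ⟶ Y) (M.toMod.obj X)) x y) =
      pairCoact K H (modAction N.toMod X Y) x (twistLift LinearMap.id (τ X) y) := by
    intro x y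
    induction x with
    | zero => simp
    | add x x' hx hx' => simp only [map_add, LinearMap.add_apply, hx, hx']
    | tmul f p =>
      induction y with
      | zero => simp
      | add y y' hy hy' => simp only [map_add, hy, hy']
      | tmul m q =>
        rw [twistLift_tmul, LinearMap.id_apply, pairCoact_tmul_lmulTensor]
        rfl
  have e : τ Y ∘ₗ u = β := by
    apply c.twist_id_injective hS
    rw [c.twist_comp (M.comodule Y) LinearMap.id (τ Y) u hu, hτ]
    apply TensorProduct.ext'
    intro f m
    rw [RightComodule.twist_apply, RightComodule.tensor_coact_tmul, hβ,
      ← RightComodule.twist_apply, hτ]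
    refine Eq.trans ?_ (N.coact_map f _)
    exact congrArg (N.comodule Y).coact (M.ev_naturality N f m η)
  exact LinearMap.congr_fun e (f ⊗ₜ m)

theorem exists_isCoactOf (hS : Function.Bijective (HopfAlgebra.antipode K (A := H)))
    {M : RelHopfModule K H D} (hM : M.IsFinGen) {N : RelHopfModule K H D} (η : M.DHom N) :
    ∃ z, IsCoactOf z η := by
  obtain ⟨z, hz⟩ := exists_evTensor_eq hM (twistedCoact hS η) (twistedCoact_map hS η)
  exact ⟨z, (isCoactOf_iff_twistedCoact hS z η).2 hz⟩

/-! ### The comodule structure on Hom(M, N) -/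

/-- For a finitely generated `M`, the map `id ⊗ ε` identifies `homSpace M N` with
`Hom_{D-Mod}(M, N)`. -/
noncomputable def homSpaceEquiv (hS : Function.Bijective (HopfAlgebra.antipode K (A := H)))
    {M : RelHopfModule K H D} (hM : M.IsFinGen) (N : RelHopfModule K H D) :
    M.homSpace N ≃ₗ[K] M.DHom N :=
  LinearEquiv.ofBijective (idCounit K H (M.DHom N) ∘ₗ (M.homSpace N).subtype) (by
    constructor
    · intro z z' h
      have hz := isCoactOf_of_mem_homSpace z.2
      rw [show idCounit K H (M.DHom N) z.1 = idCounit K H (M.DHom N) z'.1 from h] at hz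
      exact Subtype.ext (hz.unique hS (isCoactOf_of_mem_homSpace z'.2))
    · intro η
      obtain ⟨z, hz⟩ := exists_isCoactOf hS hM η
      exact ⟨⟨z, hz.mem_homSpace hS⟩, hz.idCounit_eq⟩)

/-- The comodule structure on `Hom_{D-Mod}(M, N)` for a finitely generated `M`. -/
noncomputable def homComodule (hS : Function.Bijective (HopfAlgebra.antipode K (A := H)))
    {M : RelHopfModule K H D} (hM : M.IsFinGen) (N : RelHopfModule K H D) :
    RightComodule K H (M.DHom N) :=
  (M.homComod N).str.congr (homSpaceEquiv hS hM N)

/-- If z in `homSpace` corresponds to η, the transported coaction sends η to (id ⊗ ε ⊗ id)(id ⊗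
Δ)(z) = z, which is a coaction of η. -/
theorem isCoactOf_homComodule (hS : Function.Bijective (HopfAlgebra.antipode K (A := H)))
    {M : RelHopfModule K H D} (hM : M.IsFinGen) {N : RelHopfModule K H D} (η : M.DHom N) :
    IsCoactOf ((homComodule hS hM N).coact η) η := by
  let z := (homSpaceEquiv hS hM N).symm η
  have h : (homComodule hS hM N).coact η = z.1 := by
    refine (LinearMap.rTensor_comp_apply H (idCounit K H (M.DHom N)) (M.homSpace N).subtype
      ((M.homComod N).str.coact z)).trans ?_
    rw [homComod_coact, rTensor_idCounit_cofree]
  have h' := isCoactOf_of_mem_homSpace z.2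
  rw [h]
  rwa [show idCounit K H (M.DHom N) z.1 = η from
    (homSpaceEquiv hS hM N).apply_symm_apply η] at h'

/-- Apply g ⊗ id to the identity for η and use the colinearity of g. With uniqueness this makes
Hom(M, -) functorial. -/
theorem IsCoactOf.comp {M N N' : RelHopfModule K H D} {z : M.DHom N ⊗[K] H} {η : M.DHom N}
    (h : IsCoactOf z η) (g : N ⟶ N') :
    IsCoactOf ((Linear.rightComp K M.toMod g.nat).rTensor H z) (η ≫ g.nat) := by
  have key : ∀ (X : D) (x : M.toMod.obj X ⊗[K] H) (y : M.DHom N ⊗[K] H),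
      (g.nat.app X).hom.rTensor H (pairCoact K H (M.ev N X) x y) =
        pairCoact K H (M.ev N' X) x ((Linear.rightComp K M.toMod g.nat).rTensor H y) := by
    intro X x y
    induction x with
    | zero => simp
    | add x x' hx hx' => simp only [map_add, LinearMap.add_apply, hx, hx']
    | tmul m p =>
      induction y with
      | zero => simp
      | add y y' hy hy' => simp only [map_add, hy, hy']
      | tmul η q => rfl
  intro X m
  rw [← key, ← h]
  exact g.colinear X _

/-! ### Hom(M, -) as a right adjoint, and its comparison with `HOM` -/

/-- For coactions on the spaces `Hom_{D-Mod}(M, N)` given by `ρ(η(m)) = ∑ η₀(m₀) ⊗ m₁ η₁`, the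
functor `Hom_{D-Mod}(M, -)` is right adjoint to `M ⊗ (-)`. -/
noncomputable def homFunctorAdj (hS : Function.Bijective (HopfAlgebra.antipode K (A := H)))
    (M : RelHopfModule K H D) (ρ : ∀ N : RelHopfModule K H D, RightComodule K H (M.DHom N))
    (h : ∀ (N : RelHopfModule K H D) (η : M.DHom N), IsCoactOf ((ρ N).coact η) η)
    (hρ : ∀ (N N' : RelHopfModule K H D) (g : N ⟶ N') (η : M.DHom N),
      (ρ N').coact (η ≫ g.nat) = (Linear.rightComp K M.toMod g.nat).rTensor H ((ρ N).coact η)) :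
    M.tensorFunctor ⊣ M.homFunctor ρ hρ :=
  Adjunction.mkOfHomEquiv
    { homEquiv := fun T N =>
        { toFun := fun φ =>
            { lin := curryHom φ.nat
              -- Colinearity of φ says that applying the curried map to the first factor of ρ(t)
              -- gives a coaction of the curried map at t; uniqueness identifies it with the given
              -- one.
              colinear := fun t => (h N _).unique hS fun X m =>
                (colinear_iff φ.nat X).1 (φ.colinear X) m t }
          invFun := fun ψ =>
            { nat := uncurryHom (N := N) ψ.lin
              colinear := fun X => (colinear_iff _ X).2 fun m t => by
                let θ : T.carrier →ₗ[K] M.DHom N := ψ.lin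
                change (N.comodule X).coact (M.ev N X m (curryHom (uncurryHom θ) t)) =
                  pairCoact K H (M.ev N X) ((M.comodule X).coact m)
                    ((curryHom (uncurryHom θ)).rTensor H (T.str.coact t))
                rw [curryHom_uncurryHom]
                exact (h N _ X m).trans (congrArg _ (ψ.colinear t)) }
          left_inv := fun φ => Hom.ext (uncurryHom_curryHom φ.nat)
          right_inv := fun ψ => ComodCat.Hom.ext (curryHom_uncurryHom (N := N) ψ.lin) }
      homEquiv_naturality_left_symm := fun f ψ => by
        apply Hom.ext
        ext X : 3
        exact TensorProduct.ext' fun m t => rfl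
      homEquiv_naturality_right := fun φ g => rfl }

/-- The counit is the uncurried identity of Hom(M, N), that is, evaluation. -/
theorem tensorComp_homFunctorAdj_counit
    (hS : Function.Bijective (HopfAlgebra.antipode K (A := H)))
    (M : RelHopfModule K H D) (ρ : ∀ N : RelHopfModule K H D, RightComodule K H (M.DHom N))
    (h : ∀ (N : RelHopfModule K H D) (η : M.DHom N), IsCoactOf ((ρ N).coact η) η)
    (hρ : ∀ (N N' : RelHopfModule K H D) (g : N ⟶ N') (η : M.DHom N),
      (ρ N').coact (η ≫ g.nat) = (Linear.rightComp K M.toMod g.nat).rTensor H ((ρ N).coact η))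
    (N : RelHopfModule K H D) (X : D) (m : M.toMod.obj X) (η : M.DHom N) :
    tensorComp (T := (M.homFunctor ρ hρ).obj N)
      ((homFunctorAdj hS M ρ h hρ).counit.app N).nat X (m ⊗ₜ η) = M.ev N X m η := by
  simp only [homFunctorAdj, Adjunction.mkOfHomEquiv_counit_app]
  rfl

end RelHopfModule
end CoHCategories

theorem proposition4p12 {K : Type k} [Field K] {H : Type w} [Ring H] [HopfAlgebra K H]
    (hS : Function.Bijective (HopfAlgebra.antipode K (A := H)))
    {D : Type w} [Category.{v} D] [Preadditive D] [Linear K D] [CoHCategory K H D]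
    (M : RelHopfModule K H D) (hM : M.IsFinGen) :
    ∃ ρ : ∀ N : RelHopfModule K H D, RightComodule K H (M.DHom N),
      (∀ (N : RelHopfModule K H D) (η : M.DHom N) (X : D) (m : M.toMod.obj X),
        (M.ev N X m).rTensor H ((ρ N).coact η) =
          RelHopfModule.twistedCoact hS η X m) ∧
      ∃ (hρ : ∀ (N N' : RelHopfModule K H D) (g : N ⟶ N') (η : M.DHom N),
          (ρ N').coact (η ≫ g.nat) =
            (Linear.rightComp K M.toMod g.nat).rTensor H ((ρ N).coact η))
        (i : M.HOM ≅ M.homFunctor ρ hρ),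
        ∀ (N : RelHopfModule K H D) (z : (M.HOM.obj N).carrier) (X : D)
          (m : M.toMod.obj X),
          M.ev N X m ((i.hom.app N).lin z) =
            RelHopfModule.tensorComp (M.HOMAdj.counit.app N).nat X (m ⊗ₜ z) := by
  have h := fun (N : RelHopfModule K H D) (η : M.DHom N) =>
    RelHopfModule.isCoactOf_homComodule hS hM η
  have hρ : ∀ (N N' : RelHopfModule K H D) (g : N ⟶ N') (η : M.DHom N),
      (RelHopfModule.homComodule hS hM N').coact (η ≫ g.nat) =
        (Linear.rightComp K M.toMod g.nat).rTensor H
          ((RelHopfModule.homComodule hS hM N).coact η) :=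
    fun N N' g η => (h N' _).unique hS ((h N η).comp g)
  let adj := RelHopfModule.homFunctorAdj hS M (RelHopfModule.homComodule hS hM) h hρ
  refine ⟨RelHopfModule.homComodule hS hM, fun N η X m => ?_, hρ,
    M.HOMAdj.rightAdjointUniq adj, fun N z X m => ?_⟩
  · exact LinearMap.congr_fun
      ((RelHopfModule.isCoactOf_iff_twistedCoact hS _ η).1 (h N η) X) m
  -- The comparison of two right adjoints intertwines their counits, and the counit of `adj` is
  -- evaluation.
  · rw [← Adjunction.rightAdjointUniq_hom_app_counit M.HOMAdj adj N]
    exact (RelHopfModule.tensorComp_homFunctorAdj_counit hS M _ h hρ N X m _).symm
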